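/- Let $M$ be an integer $d\times d$ matrix all of whose eigenvalues are greater than $1$ in absolute value, let $m=|\det M|$, and let $M^*$ be its transpose. Let $D\subset\mathbb Z^d$ be a set of digits for $M$, that is, a set of $m$ vectors that contains $\mathbf 0$ and whose elements are pairwise incongruent modulo $M\mathbb Z^d$; let $D^*$ be a set of digits for $M^*$. Let $V$ be the generalized Vilenkin group associated with $M$ and $D$: the group of sequences $x=(x_j)_{j\in\mathbb Z}$ with $x_j\in D$ and $x_j\ne\mathbf 0$ for only finitely many negative $j$, with coordinate-wise addition modulo $M$, denoted by $\oplus$, and with the group topology in which the sets $U_l=\{x\in V: x_j=\mathbf 0 \text{ for all } j\le l\}$, $l\in\mathbb Z$, form a neighbourhood basis of the neutral element. Let $\mu$ be the Haar measure on $V$ with $\mu(U_0)=1$, and let $H=\{x\in V: x_j=\mathbf 0\text{ for all } j>0\}$. Let $V^*$, $\mu^*$, $H^*$ be the same objects for $M^*$ and $D^*$. For $x\in V$, $\omega\in V^*$ put $$\chi(x,\omega)=\exp\Big(2\pi i\sum_{j\in\mathbb Z}\langle M^{-1}x_j,\omega_{1-j}\rangle\Big),$$ a sum with finitely many nonzero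 terms. The Fourier transform of $f\in L_1(V)$ is $\widehat f(\omega)=\int_V f(x)\overline{\chi(x,\omega)}\,d\mu(x)$, $\omega\in V^*$, and $\varphi\mapsto\widehat\varphi$ on $L_2(V)$ denotes its extension by continuity from $L_1(V)\cap L_2(V)$ to a map $L_2(V)\to L_2(V^*)$. Let $\varphi\in L_2(V)$. The family $(\varphi(\cdot\oplus h))_{h\in H}$, indexed by $h \in H$, is orthonormal in $L_2(V)$ if and only if $$\sum_{h^*\in H^*}|\widehat\varphi(\omega\oplus h^*)|^2=1\quad\text{for $\mu^*$-almost every }\omega\in V^*.$$ -/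

import Mathlib

open MeasureTheory Filter Topology

noncomputable section

namespace GenVilenkin

/-- A dilation matrix: an integer matrix all of whose (complex) eigenvalues have absolute value
greater than `1`. -/
def IsDilationMatrix {d : ℕ} (M : Matrix (Fin d) (Fin d) ℤ) : Prop :=
  ∀ z : ℂ, Module.End.HasEigenvalue (Matrix.toLin' (M.map (Int.cast : ℤ → ℂ))) z → 1 < ‖z‖

/-- Congruence of integer vectors modulo `M`: `l - k = M s` for some integer vector `s`. -/
def Congr {d : ℕ} (M : Matrix (Fin d) (Fin d) ℤ) (l k : Fin d → ℤ) : Prop :=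
  ∃ s : Fin d → ℤ, l - k = M.mulVec s

/-- A set of digits for `M`: it has `|det M|` elements, contains `0`, and its elements are pairwise
incongruent modulo `M`. -/
structure DigitSet {d : ℕ} (M : Matrix (Fin d) (Fin d) ℤ) where
  carrier : Finset (Fin d → ℤ)
  zero_mem : (0 : Fin d → ℤ) ∈ carrier
  card_eq : carrier.card = M.det.natAbs
  incongruent : ∀ a ∈ carrier, ∀ b ∈ carrier, Congr M a b → a = b

variable {d : ℕ} {M : Matrix (Fin d) (Fin d) ℤ}

/-- The digits, as a type. -/
def Digit (D : DigitSet M) : Type := {a : Fin d → ℤ // a ∈ D.carrier}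

/-- The integer vector underlying a digit. -/
def Digit.vec {D : DigitSet M} (a : Digit D) : Fin d → ℤ := a.1

/-- The sublattice `M ℤ^d` of `ℤ^d`. -/
abbrev sublattice (M : Matrix (Fin d) (Fin d) ℤ) : Submodule ℤ (Fin d → ℤ) :=
  LinearMap.range M.mulVecLin

theorem DigitSet.det_ne_zero (D : DigitSet M) : M.det ≠ 0 := by
  intro h
  have h1 := D.card_eq
  rw [h, Int.natAbs_zero, Finset.card_eq_zero] at h1
  have h2 := D.zero_mem
  simp [h1] at h2

theorem card_quotient_sublattice (hM : M.det ≠ 0) :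
    Nat.card ((Fin d → ℤ) ⧸ sublattice M) = M.det.natAbs := by
  have hinj : Function.Injective M.mulVecLin := by
    intro x y hxy
    exact Matrix.mulVec_injective_of_det_ne_zero hM hxy
  rw [← Submodule.natAbs_det_equiv (sublattice M) (LinearEquiv.ofInjective M.mulVecLin hinj),
    ← LinearMap.det_toLin' M]
  congr 2

theorem digit_bijective (D : DigitSet M) :
    Function.Bijective (fun a : Digit D => (sublattice M).mkQ a.vec) := by
  have hc := card_quotient_sublattice D.det_ne_zero
  have hpos : 0 < Nat.card ((Fin d → ℤ) ⧸ sublattice M) := by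
    rw [hc]; exact Int.natAbs_pos.mpr D.det_ne_zero
  have : Finite ((Fin d → ℤ) ⧸ sublattice M) := Nat.finite_of_card_ne_zero hpos.ne'
  have hD : Nat.card (Digit D) = M.det.natAbs := by
    rw [← D.card_eq]
    exact Nat.card_eq_card_toFinset (D.carrier : Set (Fin d → ℤ)) |>.trans (by simp)
  have hinj : Function.Injective (fun a : Digit D => (sublattice M).mkQ a.vec) := by
    intro a b hab
    have h1 : a.vec - b.vec ∈ sublattice M := (Submodule.Quotient.eq _).mp hab
    obtain ⟨s, hs⟩ := h1
    exact Subtype.ext (D.incongruent _ a.2 _ b.2 ⟨s, hs.symm⟩)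
  exact hinj.bijective_of_nat_card_le (by rw [hc, hD])

/-- Each residue class modulo `M` contains exactly one digit. -/
def digitEquiv (D : DigitSet M) : Digit D ≃ ((Fin d → ℤ) ⧸ sublattice M) :=
  Equiv.ofBijective _ (digit_bijective D)

/-- Addition of digits modulo `M`: `a ⊕ b` is the unique digit congruent to `a + b`. -/
instance instAddCommGroupDigit (D : DigitSet M) : AddCommGroup (Digit D) :=
  (digitEquiv D).addCommGroup

theorem Digit.vec_zero (D : DigitSet M) : (0 : Digit D).vec = 0 := by
  have : (0 : Digit D) = ⟨0, D.zero_mem⟩ := by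
    apply (digitEquiv D).injective
    rw [(digitEquiv D).zero_def, Equiv.apply_symm_apply]
    exact ((sublattice M).mkQ.map_zero).symm
  rw [this]; rfl

theorem Digit.vec_add {D : DigitSet M} (a b : Digit D) :
    Congr M (a + b).vec (a.vec + b.vec) := by
  have h : digitEquiv D (a + b) = digitEquiv D a + digitEquiv D b := by
    rw [(digitEquiv D).add_def, Equiv.apply_symm_apply]
  have h1 : (sublattice M).mkQ (a + b).vec = (sublattice M).mkQ (a.vec + b.vec) := by
    rw [map_add]; exact h
  obtain ⟨s, hs⟩ := (Submodule.Quotient.eq _).mp h1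
  exact ⟨s, hs.symm⟩

instance instFiniteDigit (D : DigitSet M) : Finite (Digit D) :=
  inferInstanceAs (Finite {a : Fin d → ℤ // a ∈ D.carrier})

/-- The two-sided digit sequences with finitely many nonzero terms of negative index, under
coordinate-wise addition modulo `M`. -/
def seqSubgroup (D : DigitSet M) : AddSubgroup (ℤ → Digit D) where
  carrier := {x | {j : ℤ | j < 0 ∧ x j ≠ 0}.Finite}
  zero_mem' := by simp
  add_mem' := by
    intro x y hx hy
    refine (hx.union hy).subset ?_
    rintro j ⟨hj, h⟩
    by_contra hc
    simp only [Set.mem_union, Set.mem_ofPred_eq, not_or, not_and, not_not] at hc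
    exact h (by rw [Pi.add_apply, hc.1 hj, hc.2 hj, add_zero])
  neg_mem' := by
    intro x hx
    simpa using hx

/-- The generalized Vilenkin group of a matrix `M` and a set `D` of its digits. -/
def Vilenkin (D : DigitSet M) : Type := seqSubgroup D

instance instAddCommGroupVilenkin (D : DigitSet M) : AddCommGroup (Vilenkin D) :=
  inferInstanceAs (AddCommGroup (seqSubgroup D))

/-- The `j`-th digit of an element. -/
def Vilenkin.coord {D : DigitSet M} (x : Vilenkin D) (j : ℤ) : Digit D := x.1 j

theorem Vilenkin.coord_ext {D : DigitSet M} {x y : Vilenkin D} (h : ∀ j, x.coord j = y.coord j) :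
    x = y := Subtype.ext (funext h)

theorem Vilenkin.coord_zero (D : DigitSet M) (j : ℤ) : (0 : Vilenkin D).coord j = 0 := rfl

theorem Vilenkin.coord_add {D : DigitSet M} (x y : Vilenkin D) (j : ℤ) :
    (x + y).coord j = x.coord j + y.coord j := rfl

theorem Vilenkin.coord_neg {D : DigitSet M} (x : Vilenkin D) (j : ℤ) :
    (-x).coord j = -x.coord j := rfl

/-- The basic neighbourhood `U_l` of the neutral element: `x_j = 0` for all `j ≤ l`. -/
def nbhd (D : DigitSet M) (l : ℤ) : AddSubgroup (Vilenkin D) where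
  carrier := {x | ∀ j ≤ l, x.coord j = 0}
  zero_mem' := fun _ _ => rfl
  add_mem' := by
    intro x y hx hy j hj
    rw [Vilenkin.coord_add, hx j hj, hy j hj, add_zero]
  neg_mem' := by
    intro x hx j hj
    rw [Vilenkin.coord_neg, hx j hj, neg_zero]

/-- The subgroup `H`: `x_j = 0` for all `j > 0`. -/
def subgroupH (D : DigitSet M) : AddSubgroup (Vilenkin D) where
  carrier := {x | ∀ j > 0, x.coord j = 0}
  zero_mem' := fun _ _ => rfl
  add_mem' := by
    intro x y hx hy j hj
    rw [Vilenkin.coord_add, hx j hj, hy j hj, add_zero]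
  neg_mem' := by
    intro x hx j hj
    rw [Vilenkin.coord_neg, hx j hj, neg_zero]

/-- The sets `U_l`, `l ∈ ℤ`, as a basis of neighbourhoods of the neutral element. -/
abbrev nbhdBasis (D : DigitSet M) : AddGroupFilterBasis (Vilenkin D) :=
  addGroupFilterBasisOfComm (Set.range fun l : ℤ => (nbhd D l : Set (Vilenkin D)))
    (Set.range_nonempty _)
    (by
      rintro _ _ ⟨l, rfl⟩ ⟨k, rfl⟩
      exact ⟨_, ⟨max l k, rfl⟩, fun x hx =>
        ⟨fun j hj => hx j (hj.trans (le_max_left _ _)),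
          fun j hj => hx j (hj.trans (le_max_right _ _))⟩⟩)
    (by rintro _ ⟨l, rfl⟩; exact (nbhd D l).zero_mem)
    (by
      rintro _ ⟨l, rfl⟩
      refine ⟨_, ⟨l, rfl⟩, ?_⟩
      rintro _ ⟨x, hx, y, hy, rfl⟩
      exact (nbhd D l).add_mem hx hy)
    (by rintro _ ⟨l, rfl⟩; exact ⟨_, ⟨l, rfl⟩, fun x hx => (nbhd D l).neg_mem hx⟩)

/-- The group topology in which the `U_l` form a neighbourhood basis of the neutral element. -/
instance instTopologicalSpaceVilenkin (D : DigitSet M) : TopologicalSpace (Vilenkin D) :=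
  (nbhdBasis D).topology

instance instIsTopologicalAddGroupVilenkin (D : DigitSet M) :
    IsTopologicalAddGroup (Vilenkin D) :=
  (nbhdBasis D).isTopologicalAddGroup

theorem nbhd_mem_nhds_zero (D : DigitSet M) (l : ℤ) :
    (nbhd D l : Set (Vilenkin D)) ∈ 𝓝 (0 : Vilenkin D) :=
  (nbhdBasis D).mem_nhds_zero ⟨l, rfl⟩

theorem isCompact_nbhd_zero (D : DigitSet M) : IsCompact (nbhd D 0 : Set (Vilenkin D)) := by
  let _ : TopologicalSpace (Digit D) := ⊥
  have : DiscreteTopology (Digit D) := ⟨rfl⟩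
  let g : (ℤ → Digit D) → Vilenkin D := fun y =>
    ⟨fun j => if j ≤ 0 then 0 else y j, by
      refine Set.Finite.subset Set.finite_empty ?_
      rintro j ⟨hj, h⟩
      exact h (if_pos hj.le)⟩
  have hg : ∀ y j, (g y).coord j = if j ≤ 0 then 0 else y j := fun _ _ => rfl
  have hcont : Continuous g := by
    rw [continuous_iff_continuousAt]
    intro y
    refine ((nbhdBasis D).nhds_hasBasis (g y)).tendsto_right_iff.mpr ?_
    rintro _ ⟨l, rfl⟩
    have hev : ∀ᶠ z in 𝓝 y, ∀ j ∈ Set.Icc (0 : ℤ) l, z j = y j := by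
      rw [eventually_all_finite (Set.finite_Icc _ _)]
      intro j _
      exact (continuous_apply j).continuousAt.eventually
        ((isOpen_discrete {y j}).mem_nhds rfl)
    filter_upwards [hev] with z hz
    refine ⟨g z - g y, ?_, by simp⟩
    intro j hj
    rw [sub_eq_add_neg, Vilenkin.coord_add, Vilenkin.coord_neg, hg, hg]
    by_cases h0 : j ≤ 0
    · simp [h0]
    · rw [if_neg h0, if_neg h0, hz j ⟨(not_le.mp h0).le, hj⟩, add_neg_cancel]
  have hrange : Set.range g = (nbhd D 0 : Set (Vilenkin D)) := by
    ext x
    constructor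
    · rintro ⟨y, rfl⟩ j hj
      rw [hg, if_pos hj]
    · intro hx
      refine ⟨x.1, Vilenkin.coord_ext fun j => ?_⟩
      rw [hg]
      split_ifs with h
      · exact (hx j h).symm
      · rfl
  rw [← hrange]
  exact isCompact_range hcont

instance instMeasurableSpaceVilenkin (D : DigitSet M) : MeasurableSpace (Vilenkin D) :=
  borel (Vilenkin D)

instance instBorelSpaceVilenkin (D : DigitSet M) : BorelSpace (Vilenkin D) := ⟨rfl⟩

/-- The set `U = U_0`, compact and with nonempty interior. -/
def unitCompact (D : DigitSet M) : TopologicalSpace.PositiveCompacts (Vilenkin D) where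
  carrier := nbhd D 0
  isCompact' := isCompact_nbhd_zero D
  interior_nonempty' := ⟨0, mem_interior_iff_mem_nhds.mpr (nbhd_mem_nhds_zero D 0)⟩

/-- The Haar measure `μ`, normalized by `μ U = 1`. -/
def haar (D : DigitSet M) : Measure (Vilenkin D) := Measure.addHaarMeasure (unitCompact D)

instance instIsAddHaarMeasureHaar (D : DigitSet M) : (haar D).IsAddHaarMeasure :=
  inferInstanceAs (Measure.addHaarMeasure (unitCompact D)).IsAddHaarMeasure

/-- The space `L₂` of the group. -/
abbrev L2 (D : DigitSet M) : Type := Lp ℂ 2 (haar D)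

/-- The shift `φ ↦ φ(· ⊕ h)` on `L₂`. -/
def shift {D : DigitSet M} (h : Vilenkin D) (φ : L2 D) : L2 D :=
  Lp.compMeasurePreserving (fun x => x + h) (measurePreserving_add_right (haar D) h) φ

/-- The number `⟨M⁻¹ a, b⟩` for digits `a` of `M` and `b` of the transpose of `M`. -/
def digitPairing {D : DigitSet M} {D' : DigitSet M.transpose} (a : Digit D) (b : Digit D') : ℝ :=
  ((M.map (Int.cast : ℤ → ℝ))⁻¹).mulVec (fun i => (a.vec i : ℝ)) ⬝ᵥ (fun i => (b.vec i : ℝ))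

theorem finite_support_digitPairing {D : DigitSet M} {D' : DigitSet M.transpose}
    (x : Vilenkin D) (ω : Vilenkin D') :
    (Function.support fun j : ℤ => digitPairing (x.coord j) (ω.coord (1 - j))).Finite := by
  have hω : ((fun j : ℤ => 1 - j) ⁻¹' {j : ℤ | j < 0 ∧ ω.1 j ≠ 0}).Finite :=
    Set.Finite.preimage (fun a _ b _ h => by simpa using h) ω.2
  have hx : {j : ℤ | j < 0 ∧ x.1 j ≠ 0}.Finite := x.2
  refine ((hx.union hω).union (Set.finite_Icc (0 : ℤ) 1)).subset ?_
  intro j hj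
  have h1 : x.1 j ≠ 0 := by
    intro h
    apply hj
    have : (x.coord j).vec = 0 := by rw [← Digit.vec_zero D]; exact congrArg Digit.vec h
    simp [digitPairing, this, ← Pi.zero_def]
  have h2 : ω.1 (1 - j) ≠ 0 := by
    intro h
    apply hj
    have : (ω.coord (1 - j)).vec = 0 := by rw [← Digit.vec_zero D']; exact congrArg Digit.vec h
    simp [digitPairing, this, ← Pi.zero_def]
  by_cases h0 : j < 0
  · exact Or.inl (Or.inl ⟨h0, h1⟩)
  · by_cases h3 : 1 - j < 0
    · exact Or.inl (Or.inr ⟨h3, h2⟩)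
    · exact Or.inr ⟨not_lt.mp h0, by omega⟩

/-- `χ(x, ω) = exp (2πi ∑_j ⟨M⁻¹ x_j, ω_{1-j}⟩)`; the sum has finitely many nonzero terms. -/
def chi {D : DigitSet M} {D' : DigitSet M.transpose} (x : Vilenkin D) (ω : Vilenkin D') : ℂ :=
  Complex.exp (2 * Real.pi * Complex.I *
    ((∑ᶠ j : ℤ, digitPairing (x.coord j) (ω.coord (1 - j)) : ℝ) : ℂ))

/-- The Fourier transform of an integrable function. -/
def fourierL1 {D : DigitSet M} (D' : DigitSet M.transpose) (f : Vilenkin D → ℂ)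
    (ω : Vilenkin D') : ℂ :=
  ∫ x, f x * (starRingEnd ℂ) (chi x ω) ∂(haar D)

open Classical in
/-- The Fourier transform on `L₁ ∩ L₂`, with values in `L₂` of the dual group (it is always
square-integrable there; the `else` branch only makes the definition total). -/
def fourierL1L2 {D : DigitSet M} (D' : DigitSet M.transpose)
    (f : {f : L2 D // Integrable f (haar D)}) : L2 D' :=
  if h : MemLp (fourierL1 D' (f.1 : Vilenkin D → ℂ)) 2 (haar D') then h.toLp _ else 0

/-- The Fourier transform on `L₂`: the extension by continuity from the dense subspace
`L₁ ∩ L₂`. -/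
def fourierL2 {D : DigitSet M} (D' : DigitSet M.transpose) (φ : L2 D) : L2 D' :=
  limUnder (comap Subtype.val (𝓝 φ)) (fourierL1L2 D')

end GenVilenkin

end

noncomputable section

namespace GenVilenkin

variable {d : ℕ} {M : Matrix (Fin d) (Fin d) ℤ}

/-! Shifts are unitary, so orthonormality says that ⟨φ, φ(·⊕h)⟩ is 1 for h = 0 and 0 for every other
h in H. By Plancherel (`inner_fourierL2`) and `fourierL2_shift`, this inner product is ∫
χ(h,ω)|φ̂(ω)|² dμ* (`inner_shift_eq_integral`). For h in H the character χ(h,·) is H*-periodic, and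
U_0 in V* is a fundamental domain for H*. The integral is therefore the h-th Fourier coefficient on
U_0 of the periodization P(ω) = Σ |φ̂(ω⊕h*)|². Haar measure on U_0 has coefficient 1 at h = 0 and 0
elsewhere (`setIntegral_chi`), and a finite measure on U_0 is determined by its coefficients
(`measure_ext_of_integral_chi`). So orthonormality means P = 1 a.e. on U_0, hence a.e. on V* by
periodicity (`integral_chi_eq_ite_iff`).

Plancherel is proved directly. Since U_n and U*_{-n} annihilate each other and μ(U_n) μ*(U*_{-n}) =
1, the integral of |f̂|² over U*_{-n} is the mean over U_n of the autocorrelation of f. It tends to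
‖f‖² because translation is continuous in L₂. The resulting isometry on L₁ ∩ L₂ extends to L₂ by
density. -/

/-! ### The pairing of digits -/

/-- The real matrix with the entries of `M`. -/
abbrev realMatrix (M : Matrix (Fin d) (Fin d) ℤ) : Matrix (Fin d) (Fin d) ℝ :=
  M.map (Int.cast : ℤ → ℝ)

/-- The real vector with the entries of `u`. -/
abbrev realVec (u : Fin d → ℤ) : Fin d → ℝ := fun i => (u i : ℝ)

theorem realVec_mulVec (u : Fin d → ℤ) :
    realVec (M.mulVec u) = (realMatrix M).mulVec (realVec u) := by
  ext i
  simp [realVec, realMatrix, Matrix.mulVec, dotProduct]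

theorem isUnit_det_realMatrix (hM : M.det ≠ 0) : IsUnit (realMatrix M).det := by
  have h : (realMatrix M).det = (M.det : ℝ) := ((Int.castRingHom ℝ).map_det M).symm
  rw [h]
  exact isUnit_iff_ne_zero.mpr (by exact_mod_cast hM)

/-- `exp (2πi ⟨M⁻¹ u, v⟩)` for integer vectors `u`, `v`. -/
def vecChar (M : Matrix (Fin d) (Fin d) ℤ) (u v : Fin d → ℤ) : ℂ :=
  Complex.exp (2 * Real.pi * Complex.I *
    (((realMatrix M)⁻¹.mulVec (realVec u) ⬝ᵥ realVec v : ℝ) : ℂ))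

theorem vecChar_add_left (u u' v : Fin d → ℤ) :
    vecChar M (u + u') v = vecChar M u v * vecChar M u' v := by
  rw [vecChar, vecChar, vecChar, ← Complex.exp_add, ← mul_add, ← Complex.ofReal_add,
    ← add_dotProduct, ← Matrix.mulVec_add]
  congr 5
  ext i
  simp [realVec]

theorem vecChar_add_right (u v v' : Fin d → ℤ) :
    vecChar M u (v + v') = vecChar M u v * vecChar M u v' := by
  rw [vecChar, vecChar, vecChar, ← Complex.exp_add, ← mul_add, ← Complex.ofReal_add,
    ← dotProduct_add]
  congr 4
  ext i
  simp [realVec]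

theorem vecChar_eq_one_iff (u v : Fin d → ℤ) :
    vecChar M u v = 1 ↔ ∃ n : ℤ, (realMatrix M)⁻¹.mulVec (realVec u) ⬝ᵥ realVec v = n := by
  rw [vecChar, Complex.exp_eq_one_iff]
  refine exists_congr fun n => ?_
  rw [mul_comm (n : ℂ), mul_right_inj' Complex.two_pi_I_ne_zero]
  exact_mod_cast Iff.rfl

/-- M⁻¹ cancels M and leaves an integer inner product. With `vecChar_mulVec_right`, the pairing
descends to residue classes, hence to digits. -/
theorem vecChar_mulVec_left (hM : M.det ≠ 0) (s v : Fin d → ℤ) :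
    vecChar M (M.mulVec s) v = 1 := by
  rw [vecChar_eq_one_iff, realVec_mulVec, Matrix.mulVec_mulVec,
    Matrix.nonsing_inv_mul _ (isUnit_det_realMatrix hM), Matrix.one_mulVec]
  exact ⟨s ⬝ᵥ v, by simp [dotProduct, realVec]⟩

theorem vecChar_mulVec_right (hM : M.det ≠ 0) (u s : Fin d → ℤ) :
    vecChar M u (M.transpose.mulVec s) = 1 := by
  have h : realMatrix M.transpose = (realMatrix M).transpose := by ext; rfl
  rw [vecChar_eq_one_iff, realVec_mulVec, h, Matrix.dotProduct_mulVec, Matrix.vecMul_transpose,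
    Matrix.mulVec_mulVec, Matrix.mul_nonsing_inv _ (isUnit_det_realMatrix hM), Matrix.one_mulVec]
  exact ⟨u ⬝ᵥ s, by simp [dotProduct, realVec]⟩

/-- Nondegeneracy: testing against the standard basis vectors shows that M⁻¹u has integer
coordinates. -/
theorem mem_sublattice_of_vecChar_left (hM : M.det ≠ 0) (u : Fin d → ℤ)
    (h : ∀ v, vecChar M u v = 1) : ∃ t, u = M.mulVec t := by
  have h1 : ∀ i, ∃ n : ℤ, (realMatrix M)⁻¹.mulVec (realVec u) i = n := by
    intro i
    obtain ⟨n, hn⟩ := (vecChar_eq_one_iff u (Pi.single i 1)).mp (h _)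
    refine ⟨n, hn ▸ ?_⟩
    have : realVec (Pi.single i 1) = Pi.single i (1 : ℝ) := by
      ext j
      by_cases hj : j = i
      · subst hj; simp [realVec]
      · simp [realVec, hj]
    rw [this, dotProduct_single_one]
  choose t ht using h1
  refine ⟨t, ?_⟩
  have h2 : realVec u = realVec (M.mulVec t) := by
    have h3 : realVec t = (realMatrix M)⁻¹.mulVec (realVec u) := by ext i; exact (ht i).symm
    rw [realVec_mulVec, h3, Matrix.mulVec_mulVec,
      Matrix.mul_nonsing_inv _ (isUnit_det_realMatrix hM), Matrix.one_mulVec]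
  ext i
  exact_mod_cast congrFun h2 i

theorem vecChar_transpose (u v : Fin d → ℤ) : vecChar M.transpose v u = vecChar M u v := by
  have h : realMatrix M.transpose = (realMatrix M).transpose := by ext; rfl
  rw [vecChar, vecChar, h, ← Matrix.transpose_nonsing_inv, Matrix.mulVec_transpose,
    ← Matrix.dotProduct_mulVec, dotProduct_comm]

theorem mem_sublattice_of_vecChar_right (hM : M.det ≠ 0) (v : Fin d → ℤ)
    (h : ∀ u, vecChar M u v = 1) : ∃ t, v = M.transpose.mulVec t :=
  mem_sublattice_of_vecChar_left (by rwa [Matrix.det_transpose]) v fun u => by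
    rw [vecChar_transpose, h]

variable {D : DigitSet M} {D' : DigitSet M.transpose}

theorem Digit.exists_congr (D : DigitSet M) (u : Fin d → ℤ) : ∃ a : Digit D, Congr M u a.vec := by
  obtain ⟨a, ha⟩ := (digit_bijective D).2 ((sublattice M).mkQ u)
  obtain ⟨s, hs⟩ := (Submodule.Quotient.eq _).mp ha.symm
  exact ⟨a, s, hs.symm⟩

theorem Digit.eq_zero_of_mulVec {a : Digit D} {t : Fin d → ℤ} (h : a.vec = M.mulVec t) :
    a = 0 := by
  refine Subtype.ext (D.incongruent _ a.2 _ (0 : Digit D).2 ⟨t, ?_⟩)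
  have := Digit.vec_zero D
  rw [Digit.vec] at this h
  rw [this, sub_zero, h]

/-- `exp (2πi ⟨M⁻¹ a, b⟩)` for digits `a`, `b`. -/
def digitChar (a : Digit D) (b : Digit D') : ℂ := vecChar M a.vec b.vec

theorem digitChar_add_left (a a' : Digit D) (b : Digit D') :
    digitChar (a + a') b = digitChar a b * digitChar a' b := by
  obtain ⟨s, hs⟩ := Digit.vec_add a a'
  rw [digitChar, sub_eq_iff_eq_add.mp hs, vecChar_add_left, vecChar_mulVec_left D.det_ne_zero,
    one_mul, vecChar_add_left]
  rfl

theorem digitChar_add_right (a : Digit D) (b b' : Digit D') :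
    digitChar a (b + b') = digitChar a b * digitChar a b' := by
  obtain ⟨s, hs⟩ := Digit.vec_add b b'
  rw [digitChar, sub_eq_iff_eq_add.mp hs, vecChar_add_right, vecChar_mulVec_right D.det_ne_zero,
    one_mul, vecChar_add_right]
  rfl

theorem digitChar_zero_left (b : Digit D') : digitChar (0 : Digit D) b = 1 := by
  rw [digitChar, Digit.vec_zero, ← M.mulVec_zero, vecChar_mulVec_left D.det_ne_zero]

theorem digitChar_zero_right (a : Digit D) : digitChar a (0 : Digit D') = 1 := by
  rw [digitChar, Digit.vec_zero, ← M.transpose.mulVec_zero, vecChar_mulVec_right D.det_ne_zero]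

/-- Digits represent all residue classes, so a digit pairing trivially with all digits pairs
trivially with all integer vectors and lies in Mℤ^d. -/
theorem exists_digitChar_ne_one_left {a : Digit D} (ha : a ≠ 0) :
    ∃ b : Digit D', digitChar a b ≠ 1 := by
  by_contra! h
  obtain ⟨t, ht⟩ := mem_sublattice_of_vecChar_left D.det_ne_zero a.vec fun v => by
    obtain ⟨b, s, hs⟩ := Digit.exists_congr D' v
    rw [sub_eq_iff_eq_add.mp hs, vecChar_add_right, vecChar_mulVec_right D.det_ne_zero, one_mul]
    exact h b
  exact ha (Digit.eq_zero_of_mulVec ht)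

theorem exists_digitChar_ne_one_right {b : Digit D'} (hb : b ≠ 0) :
    ∃ a : Digit D, digitChar a b ≠ 1 := by
  by_contra! h
  obtain ⟨t, ht⟩ := mem_sublattice_of_vecChar_right D.det_ne_zero b.vec fun u => by
    obtain ⟨a, s, hs⟩ := Digit.exists_congr D u
    rw [sub_eq_iff_eq_add.mp hs, vecChar_add_left, vecChar_mulVec_left D.det_ne_zero, one_mul]
    exact h a
  exact hb (Digit.eq_zero_of_mulVec ht)

/-! ### The characters `χ` -/

theorem finite_mulSupport_digitChar (x : Vilenkin D) (ω : Vilenkin D') :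
    (Function.mulSupport fun j : ℤ => digitChar (x.coord j) (ω.coord (1 - j))).Finite := by
  refine (finite_support_digitPairing x ω).subset fun j hj h0 => hj ?_
  have : digitChar (x.coord j) (ω.coord (1 - j)) = Complex.exp (2 * Real.pi * Complex.I *
    ((digitPairing (x.coord j) (ω.coord (1 - j)) : ℝ) : ℂ)) := rfl
  simp only [this, h0, Complex.ofReal_zero, mul_zero, Complex.exp_zero]

theorem chi_eq_finprod (x : Vilenkin D) (ω : Vilenkin D') :
    chi x ω = ∏ᶠ j : ℤ, digitChar (x.coord j) (ω.coord (1 - j)) := by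
  have h1 := finite_support_digitPairing x ω
  have h2 := finite_mulSupport_digitChar x ω
  rw [chi, finsum_eq_sum_of_support_subset (s := (h1.union h2).toFinset) _ (by simp),
    finprod_eq_prod_of_mulSupport_subset (s := (h1.union h2).toFinset) _ (by simp),
    Complex.ofReal_sum, Finset.mul_sum, Complex.exp_sum]
  rfl

theorem chi_add_left (x y : Vilenkin D) (ω : Vilenkin D') :
    chi (x + y) ω = chi x ω * chi y ω := by
  rw [chi_eq_finprod, chi_eq_finprod, chi_eq_finprod,
    ← finprod_mul_distrib (finite_mulSupport_digitChar x ω) (finite_mulSupport_digitChar y ω)]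
  exact finprod_congr fun j => digitChar_add_left _ _ _

theorem chi_add_right (x : Vilenkin D) (ω ω' : Vilenkin D') :
    chi x (ω + ω') = chi x ω * chi x ω' := by
  rw [chi_eq_finprod, chi_eq_finprod, chi_eq_finprod,
    ← finprod_mul_distrib (finite_mulSupport_digitChar x ω) (finite_mulSupport_digitChar x ω')]
  exact finprod_congr fun j => digitChar_add_right _ _ _

theorem chi_eq_one_of_forall {x : Vilenkin D} {ω : Vilenkin D'}
    (h : ∀ j, x.coord j = 0 ∨ ω.coord (1 - j) = 0) : chi x ω = 1 := by
  rw [chi_eq_finprod]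
  refine finprod_eq_one_of_forall_eq_one fun j => ?_
  rcases h j with h | h
  · rw [h, digitChar_zero_left]
  · rw [h, digitChar_zero_right]

theorem chi_zero_left (ω : Vilenkin D') : chi (0 : Vilenkin D) ω = 1 :=
  chi_eq_one_of_forall fun j => Or.inl (Vilenkin.coord_zero D j)

theorem norm_chi (x : Vilenkin D) (ω : Vilenkin D') : ‖chi x ω‖ = 1 := by
  rw [chi, mul_right_comm, ← Complex.ofReal_ofNat, ← Complex.ofReal_mul, ← Complex.ofReal_mul]
  exact Complex.norm_exp_ofReal_mul_I _

theorem chi_mul_conj (x : Vilenkin D) (ω : Vilenkin D') :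
    chi x ω * (starRingEnd ℂ) (chi x ω) = 1 := by
  rw [Complex.mul_conj, Complex.normSq_eq_norm_sq, norm_chi]
  simp

theorem chi_ne_zero (x : Vilenkin D) (ω : Vilenkin D') : chi x ω ≠ 0 := Complex.exp_ne_zero _

theorem chi_neg_left (x : Vilenkin D) (ω : Vilenkin D') :
    chi (-x) ω = (starRingEnd ℂ) (chi x ω) := by
  apply mul_left_cancel₀ (chi_ne_zero x ω)
  rw [← chi_add_left, add_neg_cancel, chi_zero_left, chi_mul_conj]

/-- If j > l then 1 - j ≤ -l ≤ k, so in each factor one of the two digits is zero. -/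
theorem chi_eq_one_of_mem_nbhd {x : Vilenkin D} {ω : Vilenkin D'} {l k : ℤ} (hlk : 0 ≤ l + k)
    (hx : x ∈ nbhd D l) (hω : ω ∈ nbhd D' k) : chi x ω = 1 :=
  chi_eq_one_of_forall fun j => by
    rcases le_or_gt j l with h | h
    · exact Or.inl (hx j h)
    · exact Or.inr (hω _ (by omega))

theorem chi_eq_one_of_mem_subgroupH {x : Vilenkin D} {ω : Vilenkin D'}
    (hx : x ∈ subgroupH D) (hω : ω ∈ subgroupH D') : chi x ω = 1 :=
  chi_eq_one_of_forall fun j => by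
    rcases le_or_gt j 0 with h | h
    · exact Or.inr (hω _ (by omega))
    · exact Or.inl (hx j h)

/-- The sequence with the digit `a` at the place `j` and zeros elsewhere. -/
def single (j : ℤ) (a : Digit D) : Vilenkin D :=
  ⟨Pi.single j a, (Set.finite_singleton j).subset fun k hk => by
    by_contra h
    exact hk.2 (Pi.single_eq_of_ne (M := fun _ => Digit D) h a)⟩

theorem coord_single_same (j : ℤ) (a : Digit D) : (single j a).coord j = a :=
  Pi.single_eq_same (M := fun _ => Digit D) j a

theorem coord_single_of_ne {j k : ℤ} (h : k ≠ j) (a : Digit D) : (single j a).coord k = 0 :=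
  Pi.single_eq_of_ne (M := fun _ => Digit D) h a

theorem chi_single_left (j : ℤ) (a : Digit D) (ω : Vilenkin D') :
    chi (single j a) ω = digitChar a (ω.coord (1 - j)) := by
  rw [chi_eq_finprod, finprod_eq_single _ j, coord_single_same]
  intro k hk
  rw [coord_single_of_ne hk, digitChar_zero_left]

theorem chi_single_right (j : ℤ) (b : Digit D') (x : Vilenkin D) :
    chi x (single j b) = digitChar (x.coord (1 - j)) b := by
  rw [chi_eq_finprod, finprod_eq_single _ (1 - j), sub_sub_cancel, coord_single_same]
  intro k hk
  rw [coord_single_of_ne (by omega), digitChar_zero_right]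

theorem single_mem_nbhd {j l : ℤ} (h : l < j) (a : Digit D) : single j a ∈ nbhd D l :=
  fun k hk => coord_single_of_ne (by omega) a

theorem single_mem_subgroupH {j : ℤ} (h : j ≤ 0) (a : Digit D) : single j a ∈ subgroupH D :=
  fun k hk => coord_single_of_ne (by omega) a

/-- With `chi_eq_one_of_mem_nbhd`, this makes U_l the exact annihilator of U*_{-l}. A sequence with
its only digit at 1 - j detects x_j alone, and j ≤ l puts it in U*_{-l}. -/
theorem exists_chi_ne_one_of_not_mem_nbhd {x : Vilenkin D} {l : ℤ} (hx : x ∉ nbhd D l) :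
    ∃ ω ∈ nbhd D' (-l), chi x ω ≠ 1 := by
  have : ∃ j ≤ l, x.coord j ≠ 0 := by
    by_contra! h
    exact hx h
  obtain ⟨j, hj, hxj⟩ := this
  obtain ⟨b, hb⟩ := exists_digitChar_ne_one_left (D' := D') hxj
  exact ⟨single (1 - j) b, single_mem_nbhd (by omega) b, by
    rwa [chi_single_right, sub_sub_cancel]⟩

/-! ### Topology of the group -/

theorem exists_mem_nbhd (x : Vilenkin D) : ∃ l₀ : ℤ, ∀ l ≤ l₀, x ∈ nbhd D l := by
  have hx : {j : ℤ | j < 0 ∧ x.1 j ≠ 0}.Finite := x.2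
  obtain ⟨b, hb⟩ := hx.bddBelow
  refine ⟨min b 0 - 1, fun l hl j hj => ?_⟩
  by_contra h
  have h1 : b ≤ j := hb ⟨by omega, h⟩
  omega

theorem nbhd_antitone (D : DigitSet M) {k l : ℤ} (h : k ≤ l) : nbhd D l ≤ nbhd D k :=
  fun _ hx j hj => hx j (hj.trans h)

theorem isOpen_nbhd (D : DigitSet M) (l : ℤ) : IsOpen (nbhd D l : Set (Vilenkin D)) :=
  AddSubgroup.isOpen_of_mem_nhds (nbhd D l) (nbhd_mem_nhds_zero D l)

theorem measurableSet_nbhd (D : DigitSet M) (l : ℤ) :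
    MeasurableSet (nbhd D l : Set (Vilenkin D)) := (isOpen_nbhd D l).measurableSet

theorem nhds_hasBasis (x : Vilenkin D) :
    (𝓝 x).HasBasis (fun _ : ℤ => True) fun l => {y | y - x ∈ nbhd D l} := by
  have := (nbhdBasis D).nhds_hasBasis x
  refine this.to_hasBasis ?_ ?_
  · rintro _ ⟨l, rfl⟩
    exact ⟨l, trivial, fun y hy => ⟨y - x, hy, by simp⟩⟩
  · intro l _
    refine ⟨_, ⟨l, rfl⟩, ?_⟩
    rintro _ ⟨u, hu, rfl⟩
    simpa using hu

instance instT2SpaceVilenkin (D : DigitSet M) : T2Space (Vilenkin D) := by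
  refine IsTopologicalAddGroup.t2Space_of_zero_sep fun x hx => ?_
  have : ∃ j, x.coord j ≠ 0 := by
    by_contra! h
    exact hx (Vilenkin.coord_ext h)
  obtain ⟨j, hj⟩ := this
  exact ⟨nbhd D j, nbhd_mem_nhds_zero D j, fun h => hj (h j le_rfl)⟩

instance instLocallyCompactSpaceVilenkin (D : DigitSet M) : LocallyCompactSpace (Vilenkin D) :=
  (isCompact_nbhd_zero D).locallyCompactSpace_of_mem_nhds_of_addGroup (nbhd_mem_nhds_zero D 0)

/-- The sequence of the values of a finitely supported function. -/
def ofFinsupp (f : ℤ →₀ Digit D) : Vilenkin D :=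
  ⟨f, f.hasFiniteSupport.subset fun _ hj => hj.2⟩

theorem coord_ofFinsupp (f : ℤ →₀ Digit D) (j : ℤ) : (ofFinsupp f).coord j = f j := rfl

theorem exists_ofFinsupp_sub_mem (x : Vilenkin D) (l : ℤ) :
    ∃ f : ℤ →₀ Digit D, x - ofFinsupp f ∈ nbhd D l := by
  obtain ⟨k, hk⟩ := exists_mem_nbhd x
  refine ⟨Finsupp.onFinset (Finset.Icc k l) (fun j => if j ≤ l then x.coord j else 0) ?_, ?_⟩
  · intro j hj
    simp only [ne_eq, ite_eq_right_iff, Classical.not_imp] at hj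
    refine Finset.mem_Icc.mpr ⟨?_, hj.1⟩
    by_contra h
    exact hj.2 (hk k le_rfl j (by omega))
  · intro j hj
    rw [sub_eq_add_neg, Vilenkin.coord_add, Vilenkin.coord_neg, coord_ofFinsupp,
      Finsupp.onFinset_apply, if_pos hj, add_neg_cancel]

theorem isOpen_coset (a : Vilenkin D) (l : ℤ) : IsOpen {x | x - a ∈ nbhd D l} :=
  (isOpen_nbhd D l).preimage (continuous_id.sub continuous_const)

/-- Second countability makes continuous functions on products measurable for the product σ-algebra,
as Fubini requires. -/
instance instSecondCountableTopologyVilenkin (D : DigitSet M) :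
    SecondCountableTopology (Vilenkin D) := by
  have : TopologicalSpace.IsTopologicalBasis (Set.range fun p : (ℤ →₀ Digit D) × ℤ =>
      {x : Vilenkin D | x - ofFinsupp p.1 ∈ nbhd D p.2}) := by
    refine TopologicalSpace.isTopologicalBasis_of_isOpen_of_nhds ?_ ?_
    · rintro _ ⟨p, rfl⟩
      exact isOpen_coset _ _
    · intro x u hx hu
      obtain ⟨l, -, hl⟩ := (nhds_hasBasis x).mem_iff.mp (hu.mem_nhds hx)
      obtain ⟨f, hf⟩ := exists_ofFinsupp_sub_mem x l
      refine ⟨_, ⟨(f, l), rfl⟩, hf, fun y hy => hl ?_⟩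
      have := (nbhd D l).sub_mem hy hf
      rwa [sub_sub_sub_cancel_right] at this
  exact this.secondCountableTopology (Set.countable_range _)

/-- An element of H is determined modulo U_0 by finitely many digits, and H meets U_0 only in zero.
-/
instance instCountableSubgroupH (D : DigitSet M) : Countable (subgroupH D) := by
  choose f hf using fun x : subgroupH D => exists_ofFinsupp_sub_mem (x : Vilenkin D) 0
  refine Function.Injective.countable (f := f) fun x y hxy => Subtype.ext ?_
  refine sub_eq_zero.mp (Vilenkin.coord_ext fun j => ?_)
  rcases le_or_gt j 0 with hj | hj
  · have h := (nbhd D 0).sub_mem (hf x) (hf y)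
    rw [hxy, sub_sub_sub_cancel_right] at h
    exact h j hj
  · exact (subgroupH D).sub_mem x.2 y.2 j hj

/-- χ is locally constant: for x ∈ U_k and ω ∈ U_l, perturbations lying in U_N with N ≥ max(0, -k,
-l) make all three correction factors equal to 1. -/
theorem continuous_chi : Continuous fun p : Vilenkin D × Vilenkin D' => chi p.1 p.2 := by
  refine continuous_iff_continuousAt.mpr fun ⟨x, ω⟩ => ?_
  obtain ⟨k, hk⟩ := exists_mem_nbhd x
  obtain ⟨l, hl⟩ := exists_mem_nbhd ω
  refine (continuousAt_const (y := chi x ω)).congr ?_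
  rw [nhds_prod_eq]
  have hx := (nhds_hasBasis x).mem_of_mem (i := max 0 (max (-k) (-l))) trivial
  have hω := (nhds_hasBasis ω).mem_of_mem (i := max 0 (max (-k) (-l))) trivial
  filter_upwards [prod_mem_prod hx hω] with p hp
  obtain ⟨h1, h2⟩ := hp
  have e1 : p.1 = x + (p.1 - x) := by abel
  have e2 : p.2 = ω + (p.2 - ω) := by abel
  rw [e1, e2, chi_add_left, chi_add_right, chi_add_right,
    chi_eq_one_of_mem_nbhd (l := k) (k := max 0 (max (-k) (-l))) (by omega) (hk k le_rfl) h2,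
    chi_eq_one_of_mem_nbhd (l := max 0 (max (-k) (-l))) (k := l) (by omega) h1 (hl l le_rfl),
    chi_eq_one_of_mem_nbhd (l := max 0 (max (-k) (-l))) (k := max 0 (max (-k) (-l))) (by omega)
      h1 h2]
  simp

theorem continuous_chi_left (ω : Vilenkin D') : Continuous fun x : Vilenkin D => chi x ω :=
  Continuous.comp (f := fun x : Vilenkin D => (x, ω)) (continuous_chi (D := D) (D' := D'))
    (continuous_id.prodMk continuous_const)

theorem continuous_chi_right (x : Vilenkin D) : Continuous fun ω : Vilenkin D' => chi x ω :=
  Continuous.comp (f := fun ω : Vilenkin D' => (x, ω)) (continuous_chi (D := D) (D' := D'))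
    (continuous_const.prodMk continuous_id)

/-! ### The Haar measure of the basic neighbourhoods -/

theorem card_digit (D : DigitSet M) : Nat.card (Digit D) = M.det.natAbs := by
  rw [← D.card_eq]
  exact Nat.card_eq_card_toFinset (D.carrier : Set (Fin d → ℤ)) |>.trans (by simp)

theorem haar_nbhd_zero (D : DigitSet M) : haar D (nbhd D 0) = 1 :=
  Measure.addHaarMeasure_self

/-- Sorting by the digit at place l + 1 splits U_l into |det M| disjoint translates of U_{l+1}. -/
theorem haar_nbhd_eq_mul (D : DigitSet M) (l : ℤ) :
    haar D (nbhd D l) = M.det.natAbs * haar D (nbhd D (l + 1)) := by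
  have hU : (nbhd D l : Set (Vilenkin D)) =
      ⋃ a : Digit D, (fun x => -single (l + 1) a + x) ⁻¹' (nbhd D (l + 1)) := by
    ext x
    simp only [SetLike.mem_coe, Set.mem_iUnion, Set.mem_preimage]
    constructor
    · intro hx
      refine ⟨x.coord (l + 1), fun j hj => ?_⟩
      rw [Vilenkin.coord_add, Vilenkin.coord_neg]
      rcases eq_or_ne j (l + 1) with rfl | h
      · rw [coord_single_same, neg_add_cancel]
      · rw [coord_single_of_ne h, hx j (by omega), neg_zero, add_zero]
    · rintro ⟨a, ha⟩
      have := (nbhd D l).add_mem (single_mem_nbhd (lt_add_one l) a)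
        (nbhd_antitone D (lt_add_one l).le ha)
      rwa [add_neg_cancel_left] at this
  have hd : Pairwise (Function.onFun Disjoint fun a : Digit D =>
      (fun x => -single (l + 1) a + x) ⁻¹' (nbhd D (l + 1) : Set (Vilenkin D))) := by
    intro a b hab
    refine Set.disjoint_left.mpr fun x hx hy => hab ?_
    have h := (nbhd D (l + 1)).sub_mem hx hy (l + 1) le_rfl
    rw [add_sub_add_right_eq_sub, sub_eq_add_neg, neg_neg, Vilenkin.coord_add, Vilenkin.coord_neg,
      coord_single_same, coord_single_same] at h
    exact (neg_add_eq_zero.mp h)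
  have := Fintype.ofFinite (Digit D)
  rw [hU, measure_iUnion hd fun a => (measurable_const_add _) (measurableSet_nbhd D _)]
  simp only [measure_preimage_add, tsum_fintype, Finset.sum_const, Finset.card_univ, nsmul_eq_mul]
  rw [← Nat.card_eq_fintype_card, card_digit]

theorem haar_nbhd_neg (D : DigitSet M) (n : ℕ) :
    haar D (nbhd D (-n)) = (M.det.natAbs : ENNReal) ^ n := by
  induction n with
  | zero => simpa using haar_nbhd_zero D
  | succ n ih =>
    rw [haar_nbhd_eq_mul, pow_succ', ← ih]
    congr 4
    push_cast
    ring

theorem haar_nbhd_natCast_mul (D : DigitSet M) (n : ℕ) :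
    (M.det.natAbs : ENNReal) ^ n * haar D (nbhd D n) = 1 := by
  induction n with
  | zero => simpa using haar_nbhd_zero D
  | succ n ih =>
    rw [← ih, haar_nbhd_eq_mul D n, pow_succ, mul_assoc]
    norm_cast

/-- The two normalizations are dual to each other because M and its transpose have the same
determinant; hence Plancherel holds with constant 1. -/
theorem haar_nbhd_mul_haar_nbhd (D : DigitSet M) (D' : DigitSet M.transpose) (n : ℕ) :
    haar D' (nbhd D' (-n)) * haar D (nbhd D n) = 1 := by
  rw [haar_nbhd_neg, Matrix.det_transpose, haar_nbhd_natCast_mul]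

theorem haar_nbhd_lt_top (D : DigitSet M) (l : ℤ) : haar D (nbhd D l) < ⊤ := by
  obtain ⟨n, hn⟩ : ∃ n : ℕ, -(n : ℤ) ≤ l := ⟨l.natAbs, by omega⟩
  refine (measure_mono (nbhd_antitone D hn)).trans_lt ?_
  rw [haar_nbhd_neg]
  exact ENNReal.pow_lt_top (ENNReal.natCast_lt_top _)

instance instIsFiniteMeasureRestrictNbhd (D : DigitSet M) (l : ℤ) :
    IsFiniteMeasure ((haar D).restrict (nbhd D l)) :=
  ⟨by rw [Measure.restrict_apply_univ]; exact haar_nbhd_lt_top D l⟩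

open Classical in
/-- Orthogonality: the integral of a character over a subgroup `U_k`. -/
theorem setIntegral_chi (x : Vilenkin D) (l : ℤ) :
    ∫ ω in nbhd D' (-l), chi x ω ∂(haar D') =
      if x ∈ nbhd D l then (((haar D').real (nbhd D' (-l)) : ℝ) : ℂ) else 0 := by
  split_ifs with hx
  · rw [setIntegral_congr_fun (g := fun _ => (1 : ℂ)) (measurableSet_nbhd D' _)
      fun ω hω => chi_eq_one_of_mem_nbhd (by omega) hx hω]
    simp
  · obtain ⟨η, hη, hne⟩ := exists_chi_ne_one_of_not_mem_nbhd (D' := D') hx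
    -- Translating by η, which preserves the subgroup, multiplies the integral by χ(x, η) ≠ 1, so
    -- the integral vanishes.
    have h : ∫ ω in nbhd D' (-l), chi x ω ∂(haar D') =
        chi x η * ∫ ω in nbhd D' (-l), chi x ω ∂(haar D') := by
      rw [← integral_const_mul, ← integral_indicator (measurableSet_nbhd D' _),
        ← integral_indicator (measurableSet_nbhd D' _),
        ← integral_add_left_eq_self _ η]
      refine integral_congr_ae (Eventually.of_forall fun ω => ?_)
      by_cases hω : ω ∈ nbhd D' (-l)
      · simp only
        rw [Set.indicator_of_mem (show η + ω ∈ (nbhd D' (-l) : Set _) from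
          (nbhd D' (-l)).add_mem hη hω), Set.indicator_of_mem (show ω ∈ (_ : Set _) from hω),
          chi_add_right]
      · simp only
        rw [Set.indicator_of_notMem, Set.indicator_of_notMem (show ω ∉ (_ : Set _) from hω)]
        exact fun h => hω ((AddSubgroup.add_mem_cancel_left _ hη).mp h)
    by_contra h0
    exact hne (mul_right_cancel₀ h0 (by rw [one_mul, ← h]))

/-! ### The Fourier transform on `L₁` -/

theorem integrable_mul_conj_chi {f : Vilenkin D → ℂ} (hf : Integrable f (haar D))
    (ω : Vilenkin D') : Integrable (fun x => f x * (starRingEnd ℂ) (chi x ω)) (haar D) := by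
  refine hf.mul_bdd (c := 1) ?_ (Eventually.of_forall fun x => ?_)
  · exact (Complex.continuous_conj.comp (continuous_chi_left ω)).aestronglyMeasurable
  · rw [RCLike.norm_conj, norm_chi]

theorem continuous_fourierL1 {f : Vilenkin D → ℂ} (hf : Integrable f (haar D)) :
    Continuous (fourierL1 D' f) := by
  refine continuous_of_dominated (bound := fun x => ‖f x‖)
    (fun ω => (integrable_mul_conj_chi hf ω).aestronglyMeasurable) (fun ω => ?_) hf.norm ?_
  · exact Eventually.of_forall fun x => by rw [norm_mul, RCLike.norm_conj, norm_chi, mul_one]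
  · exact Eventually.of_forall fun x => continuous_const.mul
      (Complex.continuous_conj.comp (continuous_chi_right x))

theorem norm_fourierL1_le (f : Vilenkin D → ℂ) (ω : Vilenkin D') :
    ‖fourierL1 D' f ω‖ ≤ ∫ x, ‖f x‖ ∂(haar D) := by
  refine (norm_integral_le_integral_norm _).trans_eq ?_
  simp only [norm_mul, RCLike.norm_conj, norm_chi, mul_one]

theorem integral_fourierL1_mul {f : Vilenkin D → ℂ} (hf : Integrable f (haar D))
    (ν : Measure (Vilenkin D')) [SFinite ν] {g : Vilenkin D' → ℂ} (hg : Integrable g ν) :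
    ∫ ω, fourierL1 D' f ω * g ω ∂ν =
      ∫ x, f x * ∫ ω, (starRingEnd ℂ) (chi x ω) * g ω ∂ν ∂(haar D) := by
  simp only [fourierL1, ← integral_mul_const, ← integral_const_mul, mul_assoc]
  refine integral_integral_swap ?_
  have h : Integrable (fun p : Vilenkin D' × Vilenkin D => g p.1 * f p.2) (ν.prod (haar D)) :=
    hg.mul_prod hf
  have hc : Continuous fun p : Vilenkin D' × Vilenkin D => (starRingEnd ℂ) (chi p.2 p.1) :=
    Complex.continuous_conj.comp (Continuous.comp (f := Prod.swap)
      (continuous_chi (D := D) (D' := D')) continuous_swap)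
  refine (h.mul_bdd (c := 1) hc.aestronglyMeasurable (Eventually.of_forall fun p => ?_)).congr
    (Eventually.of_forall fun p => ?_)
  · rw [RCLike.norm_conj, norm_chi]
  · simp only [Function.uncurry]
    ring

/-- A truncated inversion formula: after Fubini the kernel is the integral of χ(x - y, ·), which by
orthogonality is supported on y ∈ x + U_l. -/
theorem setIntegral_chi_mul_fourierL1 {f : Vilenkin D → ℂ} (hf : Integrable f (haar D))
    (x : Vilenkin D) (l : ℤ) :
    ∫ ω in nbhd D' (-l), chi x ω * fourierL1 D' f ω ∂(haar D') =
      (haar D').real (nbhd D' (-l)) * ∫ t in nbhd D l, f (x + t) ∂(haar D) := by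
  classical
  have h1 : ∀ y, ∫ ω in nbhd D' (-l), (starRingEnd ℂ) (chi y ω) * chi x ω ∂(haar D') =
      if -y + x ∈ nbhd D l then (((haar D').real (nbhd D' (-l)) : ℝ) : ℂ) else 0 := by
    intro y
    simp only [← chi_neg_left, ← chi_add_left]
    exact setIntegral_chi _ _
  have hint : Integrable (fun ω => chi x ω) ((haar D').restrict (nbhd D' (-l))) :=
    Integrable.of_bound (continuous_chi_right x).aestronglyMeasurable 1
      (Eventually.of_forall fun ω => (norm_chi x ω).le)
  simp only [mul_comm (chi x _)]
  rw [integral_fourierL1_mul hf _ hint, ← integral_add_left_eq_self _ x,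
    ← integral_const_mul, ← integral_indicator (measurableSet_nbhd D l)]
  refine integral_congr_ae (Eventually.of_forall fun t => ?_)
  simp only [h1]
  by_cases ht : t ∈ nbhd D l
  · rw [Set.indicator_of_mem (show t ∈ (_ : Set _) from ht), if_pos, mul_comm]
    simpa [neg_add_rev, add_assoc] using ht
  · rw [Set.indicator_of_notMem (show t ∉ (_ : Set _) from ht), if_neg, mul_zero]
    simpa [neg_add_rev, add_assoc] using ht

/-- Fubini followed by the conjugate of `setIntegral_chi_mul_fourierL1` turns the energy over
U*_{-l} into an integral of the autocorrelation over U_l. -/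
theorem setIntegral_normSq_fourierL1 {f : Vilenkin D → ℂ} (hf : Integrable f (haar D)) (l : ℤ) :
    ∫ ω in nbhd D' (-l), fourierL1 D' f ω * (starRingEnd ℂ) (fourierL1 D' f ω) ∂(haar D') =
      (haar D').real (nbhd D' (-l)) *
        ∫ t in nbhd D l, ∫ x, f x * (starRingEnd ℂ) (f (x + t)) ∂(haar D) ∂(haar D) := by
  have hint : Integrable (fun ω => (starRingEnd ℂ) (fourierL1 D' f ω))
      ((haar D').restrict (nbhd D' (-l))) :=
    Integrable.of_bound
      (Complex.continuous_conj.comp (continuous_fourierL1 hf)).aestronglyMeasurable _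
      (Eventually.of_forall fun ω => by
        rw [RCLike.norm_conj]; exact norm_fourierL1_le f ω)
  rw [integral_fourierL1_mul hf _ hint]
  simp only [← map_mul, integral_conj, setIntegral_chi_mul_fourierL1 hf]
  simp only [map_mul, Complex.conj_ofReal, mul_left_comm (f _), integral_const_mul]
  congr 1
  simp only [← integral_conj, ← integral_const_mul]
  refine integral_integral_swap ?_
  have h : Integrable (fun p : Vilenkin D × Vilenkin D => f p.1 * (starRingEnd ℂ) (f p.2))
      ((haar D).prod (haar D)) :=
    hf.mul_prod (Complex.conjLIE.integrable_comp_iff.mpr hf)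
  -- The shear (x, t) ↦ (x, x + t) preserves the product measure, so f(x) times the conjugate of f(x
  -- + t) is integrable in both variables.
  have h2 := (measurePreserving_prod_add (haar D) (haar D)).integrable_comp_of_integrable h
  refine h2.mono_measure ?_
  exact Measure.prod_mono le_rfl Measure.restrict_le_self

/-! ### Plancherel's theorem on `L₁ ∩ L₂` -/

theorem shift_coeFn (t : Vilenkin D) (φ : L2 D) :
    shift t φ =ᵐ[haar D] fun x => φ (x + t) :=
  Lp.coeFn_compMeasurePreserving φ (measurePreserving_add_right (haar D) t)

instance instRegularHaar (D : DigitSet M) : (haar D).Regular :=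
  inferInstanceAs (Measure.addHaarMeasure (unitCompact D)).Regular

theorem continuous_shift (φ : L2 D) : Continuous fun t : Vilenkin D => shift t φ := by
  let g : C(Vilenkin D, C(Vilenkin D, Vilenkin D)) :=
    (ContinuousMap.mk (fun p : Vilenkin D × Vilenkin D => p.2 + p.1) (by fun_prop)).curry
  exact (continuous_const (y := φ)).compMeasurePreservingLp g.continuous
    (fun t => measurePreserving_add_right (haar D) t) (by simp)

theorem inner_shift (t : Vilenkin D) (φ : L2 D) :
    inner ℂ (shift t φ) φ = ∫ x, φ x * (starRingEnd ℂ) (φ (x + t)) ∂(haar D) := by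
  rw [L2.inner_def]
  refine integral_congr_ae ?_
  filter_upwards [shift_coeFn t φ] with x hx
  rw [hx, RCLike.inner_apply]

theorem shift_zero (φ : L2 D) : shift 0 φ = φ := by
  refine Lp.ext ?_
  filter_upwards [shift_coeFn 0 φ] with x hx
  rw [hx, add_zero]

theorem norm_shift (t : Vilenkin D) (φ : L2 D) : ‖shift t φ‖ = ‖φ‖ :=
  Lp.norm_compMeasurePreserving φ (measurePreserving_add_right (haar D) t)

/-- The left side is the mean over U_n of the continuous function t ↦ ⟨φ(· + t), φ⟩, and U_n shrinks
to 0. -/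
theorem tendsto_setIntegral_sq_fourierL1 (φ : L2 D) (hφ : Integrable φ (haar D)) :
    Tendsto (fun n : ℕ => ∫ ω in nbhd D' (-n), ‖fourierL1 D' φ ω‖ ^ 2 ∂(haar D')) atTop
      (𝓝 (‖φ‖ ^ 2)) := by
  have hG : Continuous fun t : Vilenkin D => inner ℂ (shift t φ) φ :=
    (continuous_shift φ).inner continuous_const
  have key : ∀ n : ℕ, ((∫ ω in nbhd D' (-n), ‖fourierL1 D' φ ω‖ ^ 2 ∂(haar D') : ℝ) : ℂ) =
      (haar D').real (nbhd D' (-n)) * ∫ t in nbhd D n, inner ℂ (shift t φ) φ ∂(haar D) := by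
    intro n
    simp only [inner_shift]
    rw [← setIntegral_normSq_fourierL1 hφ, ← integral_complex_ofReal]
    simp only [Complex.mul_conj, Complex.normSq_eq_norm_sq]
  have hGint : ∀ n : ℕ, IntegrableOn (fun t => inner ℂ (shift t φ) φ) (nbhd D n) (haar D) := by
    intro n
    refine Integrable.of_bound hG.aestronglyMeasurable (‖φ‖ * ‖φ‖)
      (Eventually.of_forall fun t => (norm_inner_le_norm _ _).trans_eq ?_)
    rw [norm_shift]
  have hmul : ∀ n : ℕ, (haar D').real (nbhd D' (-n)) * (haar D).real (nbhd D n) = 1 := by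
    intro n
    rw [Measure.real, Measure.real, ← ENNReal.toReal_mul, haar_nbhd_mul_haar_nbhd,
      ENNReal.toReal_one]
  have hlim : Tendsto (fun n : ℕ => (((haar D').real (nbhd D' (-n)) : ℝ) : ℂ) *
      ∫ t in nbhd D n, inner ℂ (shift t φ) φ ∂(haar D)) atTop (𝓝 (inner ℂ (shift 0 φ) φ)) := by
    refine Metric.tendsto_atTop.mpr fun ε hε => ?_
    obtain ⟨l, -, hl⟩ := (nhds_hasBasis (0 : Vilenkin D)).mem_iff.mp
      (hG.continuousAt.preimage_mem_nhds (Metric.ball_mem_nhds _ (half_pos hε)))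
    refine ⟨l.toNat, fun n hn => ?_⟩
    -- The limit is written as the mean of a constant, so the error is the mean of a difference that
    -- is below ε/2 on U_n.
    have hconst : inner ℂ (shift 0 φ) φ = (((haar D').real (nbhd D' (-n)) : ℝ) : ℂ) *
        ∫ t in nbhd D n, inner ℂ (shift (0 : Vilenkin D) φ) φ ∂(haar D) := by
      rw [setIntegral_const, Complex.real_smul, ← mul_assoc, ← Complex.ofReal_mul, hmul,
        Complex.ofReal_one, one_mul]
    rw [dist_eq_norm, hconst, ← mul_sub, ← integral_sub (hGint n) (integrable_const _), norm_mul,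
      Complex.norm_real, Real.norm_of_nonneg measureReal_nonneg]
    have hb : ‖∫ t in nbhd D n, (inner ℂ (shift t φ) φ - inner ℂ (shift 0 φ) φ) ∂(haar D)‖ ≤
        ε / 2 * (haar D).real (nbhd D n) := by
      refine norm_setIntegral_le_of_norm_le_const (haar_nbhd_lt_top D n) fun t ht => ?_
      have := @hl t (by
        rw [Set.mem_ofPred_eq, sub_zero]
        exact nbhd_antitone D (by omega) ht)
      rw [← dist_eq_norm]
      exact (Metric.mem_ball.mp this).le
    calc _ ≤ (haar D').real (nbhd D' (-n)) * (ε / 2 * (haar D).real (nbhd D n)) :=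
          mul_le_mul_of_nonneg_left hb measureReal_nonneg
      _ = ε / 2 := by rw [mul_left_comm, hmul, mul_one]
      _ < ε := half_lt_self hε
  have h := (Complex.continuous_re.tendsto _).comp hlim
  rw [shift_zero, inner_self_eq_norm_sq_to_K] at h
  convert h using 2 with n
  · rw [Function.comp_apply, ← key, Complex.ofReal_re]
  · norm_cast

theorem lintegral_sq_fourierL1 (φ : L2 D) (hφ : Integrable φ (haar D)) :
    ∫⁻ ω, ‖fourierL1 D' φ ω‖ₑ ^ 2 ∂(haar D') = ‖φ‖ₑ ^ 2 := by
  have hc := continuous_fourierL1 (D' := D') hφ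
  have hU : (⋃ n : ℕ, (nbhd D' (-n) : Set (Vilenkin D'))) = Set.univ := by
    refine Set.eq_univ_of_forall fun ω => ?_
    obtain ⟨l, hl⟩ := exists_mem_nbhd ω
    exact Set.mem_iUnion.mpr ⟨l.natAbs, hl _ (by omega)⟩
  have hm : Monotone fun n : ℕ => (nbhd D' (-n) : Set (Vilenkin D')) :=
    fun a b hab => nbhd_antitone D' (by omega)
  -- The sets U*_{-n} exhaust V*; continuity from below is applied to the measure with density
  -- |f̂|², so integrability on all of V* need not be known beforehand.
  have h1 := tendsto_measure_iUnion_atTop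
    (μ := (haar D').withDensity fun ω => ‖fourierL1 D' φ ω‖ₑ ^ 2) hm
  rw [hU, withDensity_apply _ MeasurableSet.univ, Measure.restrict_univ] at h1
  refine tendsto_nhds_unique h1 ?_
  have h2 := ENNReal.tendsto_ofReal (tendsto_setIntegral_sq_fourierL1 (D' := D') φ hφ)
  rw [ENNReal.ofReal_pow (norm_nonneg _), ofReal_norm] at h2
  refine h2.congr fun n => ?_
  rw [Function.comp_apply, withDensity_apply _ (measurableSet_nbhd D' _),
    ofReal_integral_eq_lintegral_ofReal]
  · refine lintegral_congr fun ω => ?_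
    rw [ENNReal.ofReal_pow (norm_nonneg _), ofReal_norm]
  · refine Integrable.of_bound (hc.norm.pow 2).aestronglyMeasurable
      ((∫ x, ‖φ x‖ ∂(haar D)) ^ 2) (Eventually.of_forall fun ω => ?_)
    rw [norm_pow, norm_norm]
    exact pow_le_pow_left₀ (norm_nonneg _) (norm_fourierL1_le _ _) 2
  · exact Eventually.of_forall fun ω => sq_nonneg _

theorem eLpNorm_fourierL1 (φ : L2 D) (hφ : Integrable φ (haar D)) :
    eLpNorm (fourierL1 D' φ) 2 (haar D') = ‖φ‖ₑ := by
  have h := eLpNorm_nnreal_pow_eq_lintegral (μ := haar D') (f := fourierL1 D' φ) (p := 2)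
    two_ne_zero
  have h2 : eLpNorm (fourierL1 D' φ) 2 (haar D') ^ 2 = ‖φ‖ₑ ^ 2 := by
    rw [← lintegral_sq_fourierL1 (D' := D') φ hφ]
    simpa using h
  exact (ENNReal.pow_right_strictMono two_ne_zero).injective h2

/-- Hence the `else` branch of `fourierL1L2` is never taken. -/
theorem memLp_fourierL1 (φ : L2 D) (hφ : Integrable φ (haar D)) :
    MemLp (fourierL1 D' φ) 2 (haar D') :=
  ⟨(continuous_fourierL1 hφ).aestronglyMeasurable, by
    rw [eLpNorm_fourierL1 φ hφ]; exact enorm_lt_top⟩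

theorem fourierL1L2_coeFn (f : {f : L2 D // Integrable f (haar D)}) :
    fourierL1L2 D' f =ᵐ[haar D'] fourierL1 D' (f.1 : Vilenkin D → ℂ) := by
  rw [fourierL1L2, dif_pos (memLp_fourierL1 f.1 f.2)]
  exact MemLp.coeFn_toLp _

theorem norm_fourierL1L2 (f : {f : L2 D // Integrable f (haar D)}) :
    ‖fourierL1L2 D' f‖ = ‖f.1‖ := by
  rw [fourierL1L2, dif_pos (memLp_fourierL1 f.1 f.2), Lp.norm_toLp, eLpNorm_fourierL1 _ f.2,
    toReal_enorm]

/-! ### The Fourier transform on `L₂` -/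

/-- The subspace `L₁ ∩ L₂` of `L₂`. -/
def integrableSubmodule (D : DigitSet M) : Submodule ℂ (L2 D) where
  carrier := {f | Integrable f (haar D)}
  zero_mem' := (integrable_zero _ _ _).congr (Lp.coeFn_zero ℂ 2 (haar D)).symm
  add_mem' := fun {f g} hf hg => (Integrable.add hf hg).congr (Lp.coeFn_add f g).symm
  smul_mem' := fun c f hf => (Integrable.smul c hf).congr (Lp.coeFn_smul c f).symm

/-- The Fourier transform on `L₁ ∩ L₂` as a linear isometry. -/
def fourierIsometry (D' : DigitSet M.transpose) (D : DigitSet M) :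
    integrableSubmodule D →ₗᵢ[ℂ] L2 D' where
  toFun f := fourierL1L2 D' ⟨f.1, f.2⟩
  map_add' f g := by
    refine Lp.ext ?_
    filter_upwards [fourierL1L2_coeFn (D' := D') ⟨f.1, f.2⟩,
      fourierL1L2_coeFn (D' := D') ⟨g.1, g.2⟩, fourierL1L2_coeFn (D' := D') ⟨(f + g).1, (f + g).2⟩,
      Lp.coeFn_add (fourierL1L2 D' ⟨f.1, f.2⟩) (fourierL1L2 D' ⟨g.1, g.2⟩)] with ω h1 h2 h3 h4
    rw [h3, h4, Pi.add_apply, h1, h2, fourierL1, fourierL1, fourierL1,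
      ← integral_add (integrable_mul_conj_chi f.2 ω) (integrable_mul_conj_chi g.2 ω)]
    refine integral_congr_ae ?_
    filter_upwards [Lp.coeFn_add f.1 g.1] with x hx
    rw [Submodule.coe_add, hx, Pi.add_apply, add_mul]
  map_smul' c f := by
    refine Lp.ext ?_
    filter_upwards [fourierL1L2_coeFn (D' := D') ⟨f.1, f.2⟩,
      fourierL1L2_coeFn (D' := D') ⟨(c • f).1, (c • f).2⟩,
      Lp.coeFn_smul c (fourierL1L2 D' ⟨f.1, f.2⟩)] with ω h1 h2 h3
    rw [RingHom.id_apply, h2, h3, Pi.smul_apply, h1, fourierL1, fourierL1, smul_eq_mul,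
      ← integral_const_mul]
    refine integral_congr_ae ?_
    filter_upwards [Lp.coeFn_smul c f.1] with x hx
    rw [Submodule.coe_smul, hx, Pi.smul_apply, smul_eq_mul, mul_assoc]
  norm_map' f := norm_fourierL1L2 _

/-- A simple function in L₂ is nonzero only on a set of finite measure, so it is integrable. -/
theorem dense_integrableSubmodule (D : DigitSet M) :
    Dense (integrableSubmodule D : Set (L2 D)) := by
  refine (Lp.simpleFunc.dense (E := ℂ) (p := 2) (μ := haar D) ENNReal.ofNat_ne_top).mono ?_
  intro f hf
  have hs := (Lp.simpleFunc.memLp (⟨f, hf⟩ : Lp.simpleFunc ℂ 2 (haar D)))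
  refine ((SimpleFunc.memLp_iff_integrable two_ne_zero ENNReal.ofNat_ne_top).mp hs).congr ?_
  exact Lp.simpleFunc.toSimpleFunc_eq_toFun (⟨f, hf⟩ : Lp.simpleFunc ℂ 2 (haar D))

/-- The Fourier transform on `L₂` as a continuous linear map. -/
def fourierCLM (D' : DigitSet M.transpose) (D : DigitSet M) : L2 D →L[ℂ] L2 D' :=
  (fourierIsometry D' D).toContinuousLinearMap.extend (integrableSubmodule D).subtypeL

theorem fourierCLM_coe (f : integrableSubmodule D) :
    fourierCLM D' D f = fourierIsometry D' D f :=
  ContinuousLinearMap.extend_eq (fourierIsometry D' D).toContinuousLinearMap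
    (dense_integrableSubmodule D).denseRange_val isUniformEmbedding_subtype_val.isUniformInducing f

/-- Density makes the filter nontrivial and continuity of the extension supplies the limit, so
`limUnder` returns an actual limit and not a default value. -/
theorem fourierL2_eq_fourierCLM (φ : L2 D) : fourierL2 D' φ = fourierCLM D' D φ := by
  have hne : (comap (Subtype.val : {f : L2 D // Integrable f (haar D)} → L2 D) (𝓝 φ)).NeBot :=
    mem_closure_iff_comap_neBot.mp (dense_integrableSubmodule D φ)
  refine Tendsto.limUnder_eq ?_
  refine (((fourierCLM D' D).continuous.tendsto φ).comp tendsto_comap).congr fun f => ?_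
  exact fourierCLM_coe ⟨f.1, f.2⟩

theorem norm_fourierCLM (φ : L2 D) : ‖fourierCLM D' D φ‖ = ‖φ‖ := by
  refine congrFun ((dense_integrableSubmodule D).denseRange_val.equalizer
    (fourierCLM D' D).continuous.norm continuous_norm (funext fun f => ?_)) φ
  exact (congrArg norm (fourierCLM_coe f)).trans ((fourierIsometry D' D).norm_map f)

/-- **Plancherel's theorem**. -/
theorem inner_fourierL2 (φ ψ : L2 D) :
    inner ℂ (fourierL2 D' φ) (fourierL2 D' ψ) = inner ℂ φ ψ := by
  rw [fourierL2_eq_fourierCLM, fourierL2_eq_fourierCLM]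
  exact LinearIsometry.inner_map_map ⟨(fourierCLM D' D).toLinearMap, norm_fourierCLM⟩ φ ψ

/-! ### Shifts and the Fourier transform -/

theorem memLp_chi_mul (h : Vilenkin D) (g : L2 D') :
    MemLp (fun ω => chi h ω * g ω) 2 (haar D') := by
  refine (Lp.memLp g).of_le
    ((continuous_chi_right h).aestronglyMeasurable.mul (Lp.aestronglyMeasurable g))
    (Eventually.of_forall fun ω => ?_)
  rw [norm_mul, norm_chi, one_mul]

/-- Multiplication by the character `χ(h, ·)` on `L₂`. -/
def mulChi (h : Vilenkin D) (g : L2 D') : L2 D' := (memLp_chi_mul h g).toLp _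

theorem mulChi_coeFn (h : Vilenkin D) (g : L2 D') :
    mulChi h g =ᵐ[haar D'] fun ω => chi h ω * g ω := MemLp.coeFn_toLp _

theorem isometry_mulChi (h : Vilenkin D) : Isometry (mulChi (D' := D') h) := by
  intro g g'
  rw [Lp.edist_def, Lp.edist_def]
  refine eLpNorm_congr_norm_ae ?_
  filter_upwards [mulChi_coeFn h g, mulChi_coeFn h g'] with ω h1 h2
  rw [Pi.sub_apply, h1, h2, ← mul_sub, norm_mul, norm_chi, one_mul, Pi.sub_apply]

theorem isometry_shift (h : Vilenkin D) : Isometry (shift (D := D) h) :=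
  Lp.isometry_compMeasurePreserving (measurePreserving_add_right (haar D) h)

theorem fourierL1_comp_add (f : Vilenkin D → ℂ) (h : Vilenkin D) (ω : Vilenkin D') :
    fourierL1 D' (fun x => f (x + h)) ω = chi h ω * fourierL1 D' f ω := by
  rw [fourierL1, fourierL1, ← integral_const_mul,
    ← integral_add_right_eq_self (fun x => chi h ω * (f x * (starRingEnd ℂ) (chi x ω))) h]
  refine integral_congr_ae (Eventually.of_forall fun x => ?_)
  simp only [chi_add_left, map_mul]
  linear_combination (-f (x + h) * (starRingEnd ℂ) (chi x ω)) * chi_mul_conj h ω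

theorem fourierL1_congr {f g : Vilenkin D → ℂ} (h : f =ᵐ[haar D] g) :
    fourierL1 D' f = fourierL1 D' g := by
  ext ω
  refine integral_congr_ae ?_
  filter_upwards [h] with x hx
  rw [hx]

/-- Both sides are continuous in φ, so it suffices to change variables in the integral for φ in the
dense subspace L₁ ∩ L₂. -/
theorem fourierL2_shift (h : Vilenkin D) (φ : L2 D) :
    fourierL2 D' (shift h φ) = mulChi h (fourierL2 D' φ) := by
  rw [fourierL2_eq_fourierCLM, fourierL2_eq_fourierCLM]
  refine congrFun ((dense_integrableSubmodule D).denseRange_val.equalizer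
    ((fourierCLM D' D).continuous.comp (isometry_shift h).continuous)
    ((isometry_mulChi h).continuous.comp (fourierCLM D' D).continuous) (funext fun f => ?_)) φ
  have hs : shift h f.1 ∈ integrableSubmodule D :=
    (Integrable.comp_add_right (f := (f.1 : Vilenkin D → ℂ)) f.2 h).congr (shift_coeFn h f.1).symm
  simp only [Function.comp_apply]
  rw [fourierCLM_coe, fourierCLM_coe ⟨_, hs⟩]
  refine Lp.ext ?_
  filter_upwards [fourierL1L2_coeFn (D' := D') ⟨shift h f.1, hs⟩,
    fourierL1L2_coeFn (D' := D') ⟨f.1, f.2⟩, mulChi_coeFn h (fourierIsometry D' D f)]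
    with ω h1 h2 h3
  rw [h3]
  refine h1.trans ?_
  rw [fourierL1_congr (shift_coeFn h f.1), fourierL1_comp_add, ← h2]
  rfl

theorem inner_shift_eq_integral (h : Vilenkin D) (φ : L2 D) :
    inner ℂ φ (shift h φ) =
      ∫ ω, chi h ω * ((‖fourierL2 D' φ ω‖ ^ 2 : ℝ) : ℂ) ∂(haar D') := by
  rw [← inner_fourierL2 (D' := D'), fourierL2_shift, L2.inner_def]
  refine integral_congr_ae ?_
  filter_upwards [mulChi_coeFn h (fourierL2 D' φ)] with ω hω
  rw [hω, RCLike.inner_apply, mul_assoc, Complex.mul_conj, Complex.normSq_eq_norm_sq]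

theorem shift_add (h k : Vilenkin D) (φ : L2 D) : shift h (shift k φ) = shift (h + k) φ := by
  refine Lp.ext ?_
  filter_upwards [shift_coeFn h (shift k φ), shift_coeFn (h + k) φ,
    (measurePreserving_add_right (haar D) h).quasiMeasurePreserving.ae (shift_coeFn k φ)]
    with x h1 h2 h3
  rw [h1, h2, h3, add_assoc]

theorem inner_shift_shift (h : Vilenkin D) (φ ψ : L2 D) :
    inner ℂ (shift h φ) (shift h ψ) = inner ℂ φ ψ :=
  LinearIsometry.inner_map_map
    (Lp.compMeasurePreservingₗᵢ ℂ (fun x => x + h) (measurePreserving_add_right (haar D) h)) φ ψ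

open Classical in
theorem orthonormal_shift_iff (φ : L2 D) :
    Orthonormal ℂ (fun h : subgroupH D => shift (h : Vilenkin D) φ) ↔
      ∀ h ∈ subgroupH D, inner ℂ φ (shift h φ) = if h = 0 then (1 : ℂ) else 0 := by
  have key : ∀ h k : Vilenkin D,
      inner ℂ (shift h φ) (shift k φ) = inner ℂ φ (shift (k - h) φ) := by
    intro h k
    rw [← inner_shift_shift h φ (shift (k - h) φ), shift_add, add_sub_cancel]
  rw [orthonormal_iff_ite]
  constructor
  · intro H h hh
    have := H 0 ⟨h, hh⟩
    rw [key] at this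
    simpa [eq_comm, Subtype.ext_iff] using this
  · intro H h k
    rw [key, H _ ((subgroupH D).sub_mem k.2 h.2)]
    simp only [sub_eq_zero, Subtype.ext_iff, eq_comm (a := (k : Vilenkin D))]

/-! ### Uniqueness of Fourier coefficients of measures on `U_0` -/

/-- The finite subgroup of `H` of the sequences vanishing at all places `j ≤ -k`. -/
def truncH (D : DigitSet M) (k : ℕ) : AddSubgroup (Vilenkin D) := subgroupH D ⊓ nbhd D (-k)

instance instFiniteTruncH (D : DigitSet M) (k : ℕ) : Finite (truncH D k) := by
  refine Finite.of_injective (fun (x : truncH D k) (j : Set.Ioc (-k : ℤ) 0) => x.1.coord j)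
    fun x y hxy => Subtype.ext (Vilenkin.coord_ext fun j => ?_)
  by_cases hj : j ∈ Set.Ioc (-k : ℤ) 0
  · exact congrFun hxy ⟨j, hj⟩
  · rw [Set.mem_Ioc, not_and_or, not_lt, not_le] at hj
    rcases hj with hj | hj
    · rw [x.2.2 j hj, y.2.2 j hj]
    · rw [x.2.1 j hj, y.2.1 j hj]

instance instFintypeTruncH (D : DigitSet M) (k : ℕ) : Fintype (truncH D k) := Fintype.ofFinite _

-- The finite counterpart of `setIntegral_chi`: averaging characters over a finite piece of H gives
-- the indicator of U*_k inside U*_0.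
open Classical in
theorem sum_truncH_chi (k : ℕ) {ω : Vilenkin D'} (hω : ω ∈ nbhd D' 0) :
    ∑ h : truncH D k, chi (h : Vilenkin D) ω =
      if ω ∈ nbhd D' k then (Fintype.card (truncH D k) : ℂ) else 0 := by
  split_ifs with hk
  · rw [Finset.sum_congr rfl fun h _ => chi_eq_one_of_mem_nbhd (by omega) h.2.2 hk]
    simp
  · have : ∃ j ≤ (k : ℤ), ω.coord j ≠ 0 := by
      by_contra! h
      exact hk h
    obtain ⟨j, hj, hωj⟩ := this
    have hj0 : 0 < j := by
      by_contra h
      exact hωj (hω j (by omega))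
    obtain ⟨a, ha⟩ := exists_digitChar_ne_one_right (D := D) hωj
    -- Since 0 < j ≤ k, the place 1 - j lies in (-k, 0], exactly the range allowed in `truncH D k`.
    let s : truncH D k := ⟨single (1 - j) a, single_mem_subgroupH (by omega) a,
      single_mem_nbhd (by omega) a⟩
    have hs : chi (s : Vilenkin D) ω ≠ 1 := by
      change chi (single (1 - j) a) ω ≠ 1
      rwa [chi_single_left, sub_sub_cancel]
    have h : chi (s : Vilenkin D) ω * ∑ h : truncH D k, chi (h : Vilenkin D) ω =
        ∑ h : truncH D k, chi (h : Vilenkin D) ω := by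
      rw [Finset.mul_sum, ← Equiv.sum_comp (Equiv.addLeft s) fun h => chi (h : Vilenkin D) ω]
      exact Finset.sum_congr rfl fun h _ => (chi_add_left _ _ _).symm
    by_contra h0
    exact hs (mul_right_cancel₀ h0 (by rw [one_mul, h]))

theorem integrable_chi (x : Vilenkin D) (ν : Measure (Vilenkin D')) [IsFiniteMeasure ν] :
    Integrable (fun ω => chi x ω) ν :=
  Integrable.of_bound (continuous_chi_right x).aestronglyMeasurable 1
    (Eventually.of_forall fun ω => (norm_chi x ω).le)

theorem measurableSet_coset (a : Vilenkin D') (l : ℤ) : MeasurableSet {ω | ω - a ∈ nbhd D' l} :=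
  (isOpen_coset a l).measurableSet

/-- Integrating `sum_truncH_chi` at ω - a expresses the mass of a coset of U*_k as a finite
combination of Fourier coefficients. -/
theorem card_mul_measureReal_coset (ν : Measure (Vilenkin D')) [IsFiniteMeasure ν]
    (hν : ∀ᵐ ω ∂ν, ω ∈ nbhd D' 0) (k : ℕ) {a : Vilenkin D'} (ha : a ∈ nbhd D' 0) :
    (Fintype.card (truncH D k) : ℂ) * (ν.real {ω | ω - a ∈ nbhd D' k} : ℝ) =
      ∑ h : truncH D k, chi (h : Vilenkin D) (-a) * ∫ ω, chi (h : Vilenkin D) ω ∂ν := by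
  classical
  simp only [← integral_const_mul]
  rw [← integral_finsetSum _ fun (h : truncH D k) _ =>
    (integrable_chi (h : Vilenkin D) ν).const_mul _]
  have h1 : ∫ ω, {ω | ω - a ∈ nbhd D' k}.indicator
      (fun _ => (Fintype.card (truncH D k) : ℂ)) ω ∂ν =
      (Fintype.card (truncH D k) : ℂ) * (ν.real {ω | ω - a ∈ nbhd D' k} : ℝ) := by
    rw [integral_indicator (measurableSet_coset a k), setIntegral_const, Complex.real_smul,
      mul_comm]
  rw [← h1]
  refine integral_congr_ae ?_
  filter_upwards [hν] with ω hω
  simp only [← chi_add_right, neg_add_eq_sub]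
  rw [sum_truncH_chi k ((nbhd D' 0).sub_mem hω ha), Set.indicator_apply]
  rfl

theorem isTopologicalBasis_coset (D : DigitSet M) :
    TopologicalSpace.IsTopologicalBasis (Set.range fun p : Vilenkin D × ℕ =>
      {x : Vilenkin D | x - p.1 ∈ nbhd D p.2}) := by
  refine TopologicalSpace.isTopologicalBasis_of_isOpen_of_nhds ?_ ?_
  · rintro _ ⟨p, rfl⟩
    exact isOpen_coset _ _
  · intro x u hx hu
    obtain ⟨l, -, hl⟩ := (nhds_hasBasis x).mem_iff.mp (hu.mem_nhds hx)
    refine ⟨_, ⟨(x, l.toNat), rfl⟩, ?_, fun y hy => hl ?_⟩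
    · simp
    · exact nbhd_antitone D (by simp) hy

/-- Two cosets that meet can be recentred at a common point; they are then nested. -/
theorem isPiSystem_coset (D : DigitSet M) :
    IsPiSystem (Set.range fun p : Vilenkin D × ℕ => {x : Vilenkin D | x - p.1 ∈ nbhd D p.2}) := by
  rintro _ ⟨⟨a, k⟩, rfl⟩ _ ⟨⟨b, l⟩, rfl⟩ ⟨x, hx, hy⟩
  refine ⟨(x, max k l), ?_⟩
  have key : ∀ (c : Vilenkin D) (n : ℤ), x - c ∈ nbhd D n →
      ∀ y, y - c ∈ nbhd D n ↔ y - x ∈ nbhd D n := by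
    intro c n hc y
    rw [← sub_add_sub_cancel y x c]
    exact AddSubgroup.add_mem_cancel_right _ hc
  ext y
  simp only [Set.mem_inter_iff, Set.mem_ofPred_eq] at hx hy ⊢
  rw [key a k hx, key b l hy]
  constructor
  · exact fun h => ⟨nbhd_antitone D (by simp) h, nbhd_antitone D (by simp) h⟩
  · rintro ⟨h1, h2⟩ j hj
    rcases le_total k l with hkl | hkl
    · exact h2 j (by rwa [max_eq_right hkl] at hj)
    · exact h1 j (by rwa [max_eq_left hkl] at hj)

/-- Finite measures carried by `U_0` are determined by the integrals of the characters `χ(h, ·)`,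
`h ∈ H`. -/
theorem measure_ext_of_integral_chi (D : DigitSet M) {ν ρ : Measure (Vilenkin D')}
    [IsFiniteMeasure ν] [IsFiniteMeasure ρ]
    (hν : ∀ᵐ ω ∂ν, ω ∈ nbhd D' 0) (hρ : ∀ᵐ ω ∂ρ, ω ∈ nbhd D' 0)
    (h : ∀ x ∈ subgroupH D, ∫ ω, chi x ω ∂ν = ∫ ω, chi x ω ∂ρ) : ν = ρ := by
  refine ext_of_generate_finite _
    ((instBorelSpaceVilenkin D').measurable_eq.trans
      (isTopologicalBasis_coset D').borel_eq_generateFrom) (isPiSystem_coset D') ?_ ?_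
  · rintro _ ⟨⟨a, k⟩, rfl⟩
    by_cases ha : a ∈ nbhd D' 0
    · have h1 := card_mul_measureReal_coset (D := D) ν hν k ha
      rw [Finset.sum_congr rfl fun x _ => by rw [h x.1 x.2.1],
        ← card_mul_measureReal_coset (D := D) ρ hρ k ha] at h1
      have h2 := mul_left_cancel₀ (Nat.cast_ne_zero.mpr Fintype.card_ne_zero) h1
      exact (measureReal_eq_measureReal_iff).mp (by exact_mod_cast h2)
    -- A coset of U*_k, k ≥ 0, whose centre is outside U*_0 misses U*_0 altogether, so both measures
    -- give it mass 0.
    · have hsub : ∀ ω, ω - a ∈ nbhd D' k → ω ∉ nbhd D' 0 := by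
        intro ω hω h0
        have := (nbhd D' 0).sub_mem h0 (nbhd_antitone D' (by simp) hω)
        rw [sub_sub_cancel] at this
        exact ha this
      have h0 : ∀ τ : Measure (Vilenkin D'), (∀ᵐ ω ∂τ, ω ∈ nbhd D' 0) →
          τ {ω | ω - a ∈ nbhd D' k} = 0 := fun τ hτ =>
        measure_mono_null (fun ω hω => hsub ω hω) (ae_iff.mp hτ)
      rw [h0 ν hν, h0 ρ hρ]
  · have h1 := h 0 (subgroupH D).zero_mem
    simp only [chi_zero_left, integral_const, Complex.real_smul, mul_one] at h1
    exact (measureReal_eq_measureReal_iff).mp (by exact_mod_cast h1)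

/-! ### Periodization over `H` -/

/-- The element of `U_0` congruent to `x` modulo `H`. -/
def fold (x : Vilenkin D) : Vilenkin D :=
  ⟨fun j => if j ≤ 0 then 0 else x.coord j, by
    refine Set.Finite.subset Set.finite_empty ?_
    rintro j ⟨hj, h⟩
    exact h (if_pos hj.le)⟩

theorem coord_fold (x : Vilenkin D) (j : ℤ) :
    (fold x).coord j = if j ≤ 0 then 0 else x.coord j := rfl

theorem fold_mem (x : Vilenkin D) : fold x ∈ nbhd D 0 := fun j hj => by
  rw [coord_fold, if_pos hj]

theorem fold_sub_mem (x : Vilenkin D) : fold x - x ∈ subgroupH D := fun j hj => by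
  rw [sub_eq_add_neg, Vilenkin.coord_add, Vilenkin.coord_neg, coord_fold, if_neg (not_le.mpr hj),
    add_neg_cancel]

theorem eq_zero_of_mem_subgroupH_of_mem_nbhd {x : Vilenkin D} (h : x ∈ subgroupH D)
    (h0 : x ∈ nbhd D 0) : x = 0 := by
  refine Vilenkin.coord_ext fun j => ?_
  rcases le_or_gt j 0 with hj | hj
  · exact h0 j hj
  · exact h j hj

theorem eq_fold {x y : Vilenkin D} (hy : y ∈ nbhd D 0) (hxy : y - x ∈ subgroupH D) :
    fold x = y := by
  refine sub_eq_zero.mp (eq_zero_of_mem_subgroupH_of_mem_nbhd ?_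
    ((nbhd D 0).sub_mem (fold_mem x) hy))
  rw [← sub_sub_sub_cancel_right _ _ x]
  exact (subgroupH D).sub_mem (fold_sub_mem x) hxy

theorem continuous_fold : Continuous (fold : Vilenkin D → Vilenkin D) := by
  refine continuous_iff_continuousAt.mpr fun x => ?_
  refine ((nhds_hasBasis x).tendsto_iff (nhds_hasBasis (fold x))).mpr fun l _ =>
    ⟨l, trivial, fun y hy j hj => ?_⟩
  have h := hy j hj
  rw [sub_eq_add_neg, Vilenkin.coord_add, Vilenkin.coord_neg] at h ⊢
  rw [coord_fold, coord_fold]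
  split_ifs
  · simp
  · exact h

/-- H and H* annihilate each other, so χ(x, ·) with x ∈ H does not see the element of H* by which ω
and its fold differ. -/
theorem chi_fold {x : Vilenkin D} (hx : x ∈ subgroupH D) (ω : Vilenkin D') :
    chi x (fold ω) = chi x ω := by
  rw [← sub_add_cancel (fold ω) ω, chi_add_right,
    chi_eq_one_of_mem_subgroupH hx (fold_sub_mem ω), one_mul]

theorem isAddFundamentalDomain_nbhd (D : DigitSet M) :
    IsAddFundamentalDomain (subgroupH D) (nbhd D 0 : Set (Vilenkin D)) (haar D) := by
  refine IsAddFundamentalDomain.mk' (measurableSet_nbhd D 0).nullMeasurableSet fun x => ?_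
  refine ⟨⟨fold x - x, fold_sub_mem x⟩, ?_, ?_⟩
  · change fold x - x + x ∈ nbhd D 0
    rw [sub_add_cancel]
    exact fold_mem x
  · rintro ⟨h, hh⟩ hx
    refine Subtype.ext ?_
    have hx' : h + x ∈ nbhd D 0 := hx
    change h = fold x - x
    rw [eq_fold hx' (by rwa [add_sub_cancel_right]), add_sub_cancel_right]

/-- The integral over the group splits over the H-translates of U_0, on each of which `fold` is
translation back to U_0. Working in `ENNReal` avoids all questions of summability. -/
theorem map_fold_withDensity {F : Vilenkin D → ENNReal} (hF : Measurable F) :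
    ((haar D).withDensity F).map fold =
      ((haar D).restrict (nbhd D 0)).withDensity
        fun x => ∑' h : subgroupH D, F (x + (h : Vilenkin D)) := by
  ext s hs
  have hs' : MeasurableSet (fold ⁻¹' s) := continuous_fold.measurable hs
  rw [Measure.map_apply continuous_fold.measurable hs, withDensity_apply _ hs',
    withDensity_apply _ hs, ← lintegral_indicator hs', ← lintegral_indicator hs,
    (isAddFundamentalDomain_nbhd D).lintegral_eq_tsum'',
    ← lintegral_tsum fun h => by
      exact ((hF.indicator hs').comp (measurable_const_vadd h)).aemeasurable]
  refine setLIntegral_congr_fun (measurableSet_nbhd D 0) fun x hx => ?_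
  have hfold : ∀ h : subgroupH D, fold (h +ᵥ x) = x := fun h => eq_fold hx (by
    change x - ((h : Vilenkin D) + x) ∈ subgroupH D
    rw [sub_add_cancel_right]
    exact (subgroupH D).neg_mem h.2)
  by_cases hxs : x ∈ s
  · rw [Set.indicator_of_mem hxs]
    refine tsum_congr fun h => ?_
    rw [Set.indicator_of_mem (by rwa [Set.mem_preimage, hfold])]
    exact congrArg F (add_comm _ _)
  · rw [Set.indicator_of_notMem hxs]
    refine ENNReal.tsum_eq_zero.mpr fun h => ?_
    rw [Set.indicator_of_notMem (by rwa [Set.mem_preimage, hfold])]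

theorem measurable_periodization {F : Vilenkin D → ENNReal} (hF : Measurable F) :
    Measurable fun x => ∑' h : subgroupH D, F (x + (h : Vilenkin D)) :=
  Measurable.tsum fun _ => hF.comp (measurable_add_const _)

/-- The exceptional set is H-invariant, so it is null as soon as its part in the fundamental domain
U_0 is null. -/
theorem ae_restrict_periodization_iff (F : Vilenkin D → ENNReal) (hF : Measurable F) :
    (∀ᵐ x ∂(haar D).restrict (nbhd D 0), ∑' h : subgroupH D, F (x + (h : Vilenkin D)) = 1) ↔
      ∀ᵐ x ∂(haar D), ∑' h : subgroupH D, F (x + (h : Vilenkin D)) = 1 := by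
  refine ⟨fun h => ?_, fun h => ae_restrict_of_ae h⟩
  have hm : MeasurableSet
      {x : Vilenkin D | ¬ ∑' h : subgroupH D, F (x + (h : Vilenkin D)) = 1} :=
    ((measurable_periodization hF) (measurableSet_singleton 1)).compl
  rw [ae_iff, Measure.restrict_apply hm] at h
  refine ae_iff.mpr ((isAddFundamentalDomain_nbhd D).measure_zero_of_invariant _ ?_ h)
  intro g
  have hper : ∀ x : Vilenkin D, ∑' h : subgroupH D, F ((g : Vilenkin D) + x + (h : Vilenkin D)) =
      ∑' h : subgroupH D, F (x + (h : Vilenkin D)) := by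
    intro x
    rw [← Equiv.tsum_eq (Equiv.addLeft g) fun h : subgroupH D => F (x + (h : Vilenkin D))]
    refine tsum_congr fun h => congrArg F ?_
    simp only [Equiv.coe_addLeft, AddSubgroup.coe_add]
    abel
  ext x
  rw [Set.mem_vadd_set_iff_neg_vadd_mem, Set.mem_ofPred_eq, Set.mem_ofPred_eq,
    ← hper (-g +ᵥ x)]
  have : (g : Vilenkin D) + (-g +ᵥ x) = x := add_neg_cancel_left (g : Vilenkin D) x
  rw [this]

-- The integrals on the left are the Fourier coefficients of the folded measure F dμ*, and the
-- values required of them are those of Haar measure on U_0.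
open Classical in
theorem integral_chi_eq_ite_iff (D : DigitSet M) {F : Vilenkin D' → ENNReal} (hF : Measurable F)
    (hfin : ∫⁻ ω, F ω ∂(haar D') ≠ ⊤) :
    (∀ h ∈ subgroupH D, ∫ ω, chi h ω * ((F ω).toReal : ℂ) ∂(haar D') =
        if h = 0 then (1 : ℂ) else 0) ↔
      ∀ᵐ ω ∂(haar D'), ∑' h' : subgroupH D', F (ω + (h' : Vilenkin D')) = 1 := by
  have hfm : IsFiniteMeasure ((haar D').withDensity F) := isFiniteMeasure_withDensity hfin
  have hν : ∀ h ∈ subgroupH D, ∫ ω, chi h ω ∂(((haar D').withDensity F).map fold) =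
      ∫ ω, chi h ω * ((F ω).toReal : ℂ) ∂(haar D') := by
    intro h hh
    rw [integral_map continuous_fold.measurable.aemeasurable
      (continuous_chi_right h).aestronglyMeasurable]
    simp only [chi_fold hh]
    rw [integral_withDensity_eq_integral_toReal_smul hF (ae_lt_top hF hfin)]
    simp only [Complex.real_smul, mul_comm]
  have hρ : ∀ h ∈ subgroupH D, ∫ ω in nbhd D' 0, chi h ω ∂(haar D') =
      if h = 0 then (1 : ℂ) else 0 := by
    intro h hh
    have h1 := setIntegral_chi (D' := D') h 0
    rw [neg_zero, Measure.real, haar_nbhd_zero, ENNReal.toReal_one, Complex.ofReal_one] at h1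
    rw [h1]
    refine if_congr ⟨eq_zero_of_mem_subgroupH_of_mem_nbhd hh, ?_⟩ rfl rfl
    rintro rfl
    exact (nbhd D 0).zero_mem
  have hiff : ((haar D').withDensity F).map fold = (haar D').restrict (nbhd D' 0) ↔
      ∀ᵐ ω ∂(haar D').restrict (nbhd D' 0),
        ∑' h' : subgroupH D', F (ω + (h' : Vilenkin D')) = 1 := by
    rw [map_fold_withDensity hF]
    -- With Haar measure on U_0 written as density 1, equality of measures becomes a.e. equality of
    -- densities.
    nth_rewrite 2 [← withDensity_one (μ := (haar D').restrict (nbhd D' 0))]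
    rw [withDensity_eq_iff_of_sigmaFinite (measurable_periodization hF).aemeasurable
      measurable_one.aemeasurable]
    rfl
  rw [← ae_restrict_periodization_iff F hF, ← hiff]
  constructor
  · intro h
    refine measure_ext_of_integral_chi D ?_ (ae_restrict_mem (measurableSet_nbhd D' 0)) ?_
    · exact (ae_map_iff continuous_fold.measurable.aemeasurable (measurableSet_nbhd D' 0)).mpr
        (Eventually.of_forall fold_mem)
    · intro x hx
      rw [hν x hx, hρ x hx, h x hx]
  · intro h x hx
    rw [← hν x hx, h, hρ x hx]

/-- In `ENNReal` every sum converges, so an equation for `tsum` there already contains the real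
convergence that `HasSum` asserts. -/
theorem hasSum_sq_norm_iff {ι : Type*} (g : ι → ℂ) :
    HasSum (fun i => ‖g i‖ ^ 2) 1 ↔ ∑' i, ‖g i‖ₑ ^ 2 = 1 := by
  rw [← ENNReal.summable.hasSum_iff, ← ENNReal.coe_one]
  have h1 : (fun i => ‖g i‖ₑ ^ 2) = fun i => ((‖g i‖₊ ^ 2 : NNReal) : ENNReal) := by
    ext i
    rw [ENNReal.coe_pow]
    rfl
  rw [h1, ENNReal.hasSum_coe, ← NNReal.hasSum_coe]
  simp

end GenVilenkin

end

theorem theorem4 {d : ℕ} (M : Matrix (Fin d) (Fin d) ℤ) (hM : GenVilenkin.IsDilationMatrix M)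
    (D : GenVilenkin.DigitSet M) (D' : GenVilenkin.DigitSet M.transpose)
    (φ : GenVilenkin.L2 D) :
    Orthonormal ℂ (fun h : GenVilenkin.subgroupH D =>
      GenVilenkin.shift (h : GenVilenkin.Vilenkin D) φ) ↔
      ∀ᵐ ω ∂(GenVilenkin.haar D'),
        HasSum (fun h' : GenVilenkin.subgroupH D' =>
          ‖GenVilenkin.fourierL2 D' φ (ω + (h' : GenVilenkin.Vilenkin D'))‖ ^ 2) 1 := by
  classical
  have hF : Measurable fun ω => ‖GenVilenkin.fourierL2 D' φ ω‖ₑ ^ 2 :=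
    (Lp.stronglyMeasurable (GenVilenkin.fourierL2 D' φ)).enorm.pow_const 2
  -- Square-integrability of φ̂ makes |φ̂|² dμ* a finite measure, as uniqueness of Fourier
  -- coefficients requires.
  have hfin : ∫⁻ ω, ‖GenVilenkin.fourierL2 D' φ ω‖ₑ ^ 2 ∂(GenVilenkin.haar D') ≠ ⊤ := by
    have h := eLpNorm_nnreal_pow_eq_lintegral (μ := GenVilenkin.haar D')
      (f := GenVilenkin.fourierL2 D' φ) (p := 2) two_ne_zero
    have h2 : eLpNorm (GenVilenkin.fourierL2 D' φ) 2 (GenVilenkin.haar D') ^ 2 =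
        ∫⁻ ω, ‖GenVilenkin.fourierL2 D' φ ω‖ₑ ^ 2 ∂(GenVilenkin.haar D') := by
      simpa using h
    rw [← h2]
    exact ENNReal.pow_ne_top (Lp.eLpNorm_ne_top _)
  rw [GenVilenkin.orthonormal_shift_iff]
  simp only [GenVilenkin.hasSum_sq_norm_iff]
  rw [← GenVilenkin.integral_chi_eq_ite_iff D hF hfin]
  simp only [GenVilenkin.inner_shift_eq_integral (D' := D'), ENNReal.toReal_pow, toReal_enorm]
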